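/- A \emph{Laman graph} is a finite simple graph with $n$ vertices and exactly $2n-3$ edges such that, for every $k\ge 2$, any induced subgraph on $k$ vertices has at most $2k-3$ edges. A \emph{plane} graph is a graph together with an embedding in the plane without crossings; its \emph{angles} are the corners between edges that are consecutive in the cyclic order around a vertex (a vertex of degree one has one angle), and each angle lies in exactly one face and is incident to the two (for degree one, the single) edges bounding it. An \emph{extended weak labeling} of a plane Laman graph $G$ is a mapping from the angles of $G$ to $\{0,1\}$ satisfying the following conditions. (G0$'$) There are two adjacent special vertices $s_0$ and $s_1$ such that, for $i\in\{0,1\}$, all angles at $s_i$ are labeled $i$. (G1) For each vertex $v\notin\{s_0,s_1\}$, the labels of the angles at $v$, read in cyclic order around $v$, form a non-empty interval of $1$s and a non-empty interval of $0$s. (G2$'$) For each edge except $s_0s_1$, the two labels incident to the edge (one on each side of it) coincide at one endpoint and differ at the other. (G3) For each face, including the outer face, the labels of its angles, read in cyclic order along its boundary, form a non-empty interval of $1$s and a non-empty interval of $0$s. \textbf{Theorem.} Every plane Laman graph admits an extended weak labeling. -/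

import Mathlib

/-- A finite simple graph on `n` vertices is a *Laman graph* if it has exactly `2n - 3` edges and
every induced subgraph on `k ≥ 2` vertices has at most `2k - 3` edges
(written without subtraction). -/
structure IsLaman {V : Type*} (G : SimpleGraph V) : Prop where
  finite : Finite V
  card_edges : G.edgeSet.ncard + 3 = 2 * Nat.card V
  card_induce_edges : ∀ W : Set V, 2 ≤ W.ncard →
    (G.induce W).edgeSet.ncard + 3 ≤ 2 * W.ncard

/-- A *rotation system* on a graph: for every vertex `v`, a cyclic order of the darts (directed
edges) leaving `v`, thought of as the counterclockwise order around `v`.  It is given as a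
permutation of all darts that keeps the starting vertex and acts as a single cycle on the darts
leaving any given vertex. -/
structure RotationSystem {V : Type*} (G : SimpleGraph V) where
  /-- the next dart in counterclockwise order around the starting vertex -/
  rot : Equiv.Perm G.Dart
  rot_fst : ∀ d : G.Dart, (rot d).fst = d.fst
  rot_cycle : ∀ d e : G.Dart, d.fst = e.fst → rot.SameCycle d e

namespace RotationSystem

variable {V : Type*} {G : SimpleGraph V}

/-- An *angle* (corner) at the vertex `v` lies between a dart `d` leaving `v` and the next dart
`rot d` in counterclockwise order.  It is named by `d`, so it is the angle at `d.fst` immediately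
to the left of `d`.  The angle immediately to the right of `d` is thus `rot⁻¹ d`. -/
abbrev Angle (_R : RotationSystem G) : Type _ := G.Dart

/-- Walking along the boundary of a face with the face on the left: from the dart `d = (u, v)`
one continues with the dart that precedes `(v, u)` in the counterclockwise order at `v`.  As the
angle named by `d` lies in the face to the left of `d`, this is also the map from an angle to the
next angle of the same face. -/
def faceNext (R : RotationSystem G) : Equiv.Perm G.Dart :=
  (Function.Involutive.toPerm SimpleGraph.Dart.symm SimpleGraph.Dart.symm_involutive).trans
    R.rot.symm

/-- The facial cycles of a rotation system: the cycles of `faceNext`. -/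
def FacialCycle (R : RotationSystem G) : Type _ :=
  Quotient (Equiv.Perm.SameCycle.setoid R.faceNext)

/-- A rotation system describes an embedding in the plane (equivalently, the sphere) iff each
connected component satisfies Euler's formula `V - E + F = 2`.  As no component can exceed `2`, this
may be said by adding up over all components.  An isolated vertex has one face but no dart, so
isolated vertices are counted separately as contributing one facial cycle each.  For a connected
graph with an edge this is the usual `V - E + F = 2`. -/
def IsPlanar (R : RotationSystem G) : Prop :=
  Nat.card V + (Nat.card R.FacialCycle + Nat.card {v : V // ∀ w, ¬ G.Adj v w}) =
    G.edgeSet.ncard + 2 * Nat.card G.ConnectedComponent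

end RotationSystem

/-- A (combinatorial) embedding of `G` in the plane, up to homeomorphism of the sphere.  For a
connected graph `G` with an edge, its faces, including the outer one, are the facial cycles. (Which
face is the outer one is not recorded; extended weak labelings treat all faces alike.) -/
structure PlaneEmbedding {V : Type*} (G : SimpleGraph V) extends RotationSystem G where
  planar : toRotationSystem.IsPlanar

/-- The labels along the cycle of `p` through `x`, read cyclically, form a non-empty
interval of `0`s followed by a non-empty interval of `1`s. -/
def FormsTwoIntervals {α : Type*} (p : Equiv.Perm α) (φ : α → Fin 2) (x : α) : Prop :=
  ∃ y : α, p.SameCycle x y ∧ ∃ a b : ℕ, 0 < a ∧ 0 < b ∧ a + b = Function.minimalPeriod p y ∧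
    (∀ k, k < a → φ ((p ^ k) y) = 0) ∧ (∀ k, a ≤ k → k < a + b → φ ((p ^ k) y) = 1)

/-- An *extended weak labeling* of a plane graph: a labeling `φ` of its angles by `0` and `1`,
with special vertices `s₀` and `s₁`. -/
structure IsExtendedWeakLabeling {V : Type*} {G : SimpleGraph V} (E : PlaneEmbedding G)
    (φ : E.Angle → Fin 2) (s₀ s₁ : V) : Prop where
  /-- the special vertices are adjacent -/
  adj : G.Adj s₀ s₁
  /-- all angles at `s₀` are labeled `0` -/
  label_zero : ∀ d : G.Dart, d.fst = s₀ → φ d = 0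
  /-- all angles at `s₁` are labeled `1` -/
  label_one : ∀ d : G.Dart, d.fst = s₁ → φ d = 1
  /-- vertex rule -/
  vertex_rule : ∀ v : V, v ≠ s₀ → v ≠ s₁ →
    ∃ d : G.Dart, d.fst = v ∧ FormsTwoIntervals E.rot φ d
  /-- edge rule, for all edges except `s₀s₁`: of the two endpoints of the edge, there is exactly
  one at which the labels of the two angles incident to the edge coincide -/
  edge_rule : ∀ d : G.Dart, d.edge ≠ s(s₀, s₁) →
    Xor (φ d = φ (E.rot.symm d)) (φ d.symm = φ (E.rot.symm d.symm))
  /-- face rule -/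
  face_rule : ∀ d : G.Dart, FormsTwoIntervals E.faceNext φ d

/-! It suffices to find a relaxed labeling (`DartSystem.IsLabeling`): constant at `s` and at `t`,
obeying the edge rule, and such that every other vertex and every face merely sees both labels.
Counting then upgrades it. By the edge rule the four labels around a nonspecial edge have odd sum,
so exactly one of its ends has a label change across the edge, and exactly one of its sides has a
label change along the edge. The `2n - 4` nonspecial edges give `2n - 4` changes around vertices;
the special edge adds a change on each side, for `2n - 2` changes around faces. Half of all changes
in cyclic words are drops from `1` to `0`. So `n - 2` drops are shared by `n - 2` vertices with at
least one each, and `n - 1` drops are shared by the faces with at least one each, while Euler's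
formula gives at least `n - 1` faces. Hence each has exactly one drop, which means two intervals.
Planarity enters only here.

The relaxed labeling exists for every rotation system and every special edge, by induction through
reverse Henneberg moves. For `n ≥ 3`, a degree count yields a vertex other than `s`, `t` of degree
two or three. It is deleted, and in degree three an edge is inserted between two neighbors chosen by
`exists_not_tight` so that sparsity survives. On the way back one bit `x` stays free. If both values
created a monochromatic face, either a single old label would have two values, or the two faces
would combine into a monochromatic face of the smaller graph (`exists_face_extendTwo`,
`exists_face_extendThree`).

Cycles are handled through sets closed under the step map. These can be united and trimmed without
asking whether a deletion merges or splits cycles. -/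

/-- Finite sets of vertices and of darts, with the starting vertex `base d` of a dart, the opposite
dart `opp d`, and the next dart `cw d` in clockwise order around the starting vertex. -/
structure DartSystem (V D : Type*) where
  vert : Finset V
  darts : Finset D
  base : D → V
  opp : D → D
  cw : D → D

/-! ### Laman dart systems and relaxed labelings -/

namespace DartSystem

variable {V D : Type*} [DecidableEq V]

/-- The darts with both ends in `X`. -/
def inner (M : DartSystem V D) (X : Finset V) : Finset D :=
  M.darts.filter fun d => M.base d ∈ X ∧ M.base (M.opp d) ∈ X

/-- The darts leaving `v`. -/
def fiber (M : DartSystem V D) (v : V) : Finset D :=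
  M.darts.filter fun d => M.base d = v

/-- The dart system describes a Laman graph with a rotation system. -/
structure IsLaman (M : DartSystem V D) : Prop where
  base_mem : ∀ d ∈ M.darts, M.base d ∈ M.vert
  opp_mem : ∀ d ∈ M.darts, M.opp d ∈ M.darts
  opp_opp : ∀ d ∈ M.darts, M.opp (M.opp d) = d
  base_opp_ne : ∀ d ∈ M.darts, M.base (M.opp d) ≠ M.base d
  cw_mem : ∀ d ∈ M.darts, M.cw d ∈ M.darts
  base_cw : ∀ d ∈ M.darts, M.base (M.cw d) = M.base d
  cw_trans : ∀ S : Set D, (∀ x ∈ M.darts, x ∈ S → M.cw x ∈ S) →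
    ∀ d ∈ M.darts, ∀ e ∈ M.darts, M.base d = M.base e → d ∈ S → e ∈ S
  card_darts : M.darts.card + 6 = 4 * M.vert.card
  sparse : ∀ X ⊆ M.vert, 2 ≤ X.card → (M.inner X).card + 6 ≤ 4 * X.card

/-- A nonempty set of angles that is closed under walking along the boundary of a face, all of them
with the label `c`. -/
structure IsMonoClosed (M : DartSystem V D) (φ : D → Bool) (c : Bool) (S : Set D) : Prop where
  mem_darts : ∀ x ∈ S, x ∈ M.darts
  nonempty : S.Nonempty
  closed : ∀ x ∈ S, M.cw (M.opp x) ∈ S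
  label : ∀ x ∈ S, φ x = c

/-- A labeling of the angles in which no facial cycle and no vertex, except for `s` and `t`, sees
one label only. An angle is named by the dart to the right of it. -/
structure IsLabeling (M : DartSystem V D) (φ : D → Bool) (s t : V) : Prop where
  label_left : ∀ d ∈ M.darts, M.base d = s → φ d = false
  label_right : ∀ d ∈ M.darts, M.base d = t → φ d = true
  vertex : ∀ v ∈ M.vert, v ≠ s → v ≠ t →
    ∃ d ∈ M.darts, ∃ e ∈ M.darts, M.base d = v ∧ M.base e = v ∧ φ d ≠ φ e
  edge : ∀ d ∈ M.darts, ¬ ((M.base d = s ∨ M.base d = t) ∧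
      (M.base (M.opp d) = s ∨ M.base (M.opp d) = t)) →
    (φ d = φ (M.cw d) ↔ φ (M.opp d) ≠ φ (M.cw (M.opp d)))
  face : ∀ c S, ¬ M.IsMonoClosed φ c S

variable {M : DartSystem V D}

theorem mem_inner {X : Finset V} {d : D} :
    d ∈ M.inner X ↔ d ∈ M.darts ∧ M.base d ∈ X ∧ M.base (M.opp d) ∈ X := by
  simp [inner]

theorem mem_fiber {v : V} {d : D} : d ∈ M.fiber v ↔ d ∈ M.darts ∧ M.base d = v := by
  simp [fiber]

theorem inner_mono {X Y : Finset V} (h : X ⊆ Y) : M.inner X ⊆ M.inner Y := by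
  intro d; simp only [mem_inner]; exact fun ⟨a, b, c⟩ => ⟨a, h b, h c⟩

/-! ### Degrees, simplicity and tight sets -/

namespace IsLaman

variable (hM : M.IsLaman)
include hM

/-- `opp` is a fixed-point-free involution on the inner darts. Parity turns "slack less than two"
into "tight" in the dart count. -/
theorem even_card_inner (X : Finset V) : Even (M.inner X).card := by
  have h : ((M.inner X).card : ZMod 2) = 0 := by
    rw [Finset.card_eq_sum_ones, Nat.cast_sum]
    refine Finset.sum_involution (fun d _ => M.opp d) ?_ ?_ ?_ ?_
    · intro d _; decide
    · intro d hd _ h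
      exact hM.base_opp_ne d (mem_inner.1 hd).1 (by rw [h])
    · intro d hd
      rw [mem_inner] at hd ⊢
      exact ⟨hM.opp_mem d hd.1, hd.2.2, by rw [hM.opp_opp d hd.1]; exact hd.2.1⟩
    · intro d hd
      exact hM.opp_opp d (mem_inner.1 hd).1
  rwa [ZMod.natCast_eq_zero_iff_even] at h

theorem inner_card_le_one {X : Finset V} (h : X.card ≤ 1) : M.inner X = ∅ := by
  rw [Finset.eq_empty_iff_forall_notMem]
  intro d hd
  rw [mem_inner] at hd
  exact hM.base_opp_ne d hd.1 (Finset.card_le_one.1 h _ hd.2.2 _ hd.2.1)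

end IsLaman

variable [DecidableEq D]

/-- The map `f` with the value `d` skipped. -/
def skip (f : D → D) (d : D) : D → D := fun y => if f y = d then f d else f y

theorem inner_inter (X Y : Finset V) : M.inner X ∩ M.inner Y = M.inner (X ∩ Y) := by
  ext d; simp only [Finset.mem_inter, mem_inner]; tauto

namespace IsLaman

variable (hM : M.IsLaman)
include hM

theorem card_darts_le (u : V) :
    M.darts.card ≤ (M.inner (M.vert.erase u)).card + 2 * (M.fiber u).card := by
  have h : M.darts ⊆ M.inner (M.vert.erase u) ∪ (M.fiber u ∪ (M.fiber u).image M.opp) := by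
    intro d hd
    have h1 := hM.base_mem d hd
    have h2 := hM.opp_mem d hd
    have h3 := hM.base_mem _ h2
    have h4 := hM.opp_opp d hd
    simp only [Finset.mem_union, mem_inner, mem_fiber, Finset.mem_image, Finset.mem_erase]
    by_cases ha : M.base d = u
    · exact Or.inr (Or.inl ⟨hd, ha⟩)
    by_cases hb : M.base (M.opp d) = u
    · exact Or.inr (Or.inr ⟨_, ⟨h2, hb⟩, h4⟩)
    · exact Or.inl ⟨hd, ⟨ha, h1⟩, hb, h3⟩
  have := Finset.card_le_card h
  have := Finset.card_union_le (M.inner (M.vert.erase u)) (M.fiber u ∪ (M.fiber u).image M.opp)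
  have := Finset.card_union_le (M.fiber u) ((M.fiber u).image M.opp)
  have := Finset.card_image_le (s := M.fiber u) (f := M.opp)
  omega

theorem two_le_card_fiber (h3 : 3 ≤ M.vert.card) {u : V} (hu : u ∈ M.vert) :
    2 ≤ (M.fiber u).card := by
  have h1 := hM.card_darts_le u
  have h2 := Finset.card_erase_of_mem hu
  have h4 := hM.sparse (M.vert.erase u) (Finset.erase_subset _ _) (by omega)
  have := hM.card_darts
  omega

/-- Degrees are at least two, so a cyclic order has no fixed dart. This guarantees that skipping a
deleted dart lands on a dart different from it. -/
theorem cw_ne (h3 : 3 ≤ M.vert.card) {d : D} (hd : d ∈ M.darts) : M.cw d ≠ d := by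
  intro h
  have h1 := hM.two_le_card_fiber h3 (hM.base_mem d hd)
  have h2 : M.fiber (M.base d) ⊆ {d} := by
    intro e he
    rw [mem_fiber] at he
    have := hM.cw_trans {d} (by rintro x - rfl; exact h) d hd e he.1 he.2.symm rfl
    simpa using this
  have := Finset.card_le_card h2
  simp at this
  omega

/-- Otherwise the degree sum would be at least `4(n - 2) + 2 + 2`, which exceeds `4n - 6`. -/
theorem exists_card_fiber_le (h3 : 3 ≤ M.vert.card) {s t : V} (hs : s ∈ M.vert)
    (ht : t ∈ M.vert) (hst : s ≠ t) :
    ∃ v ∈ M.vert, v ≠ s ∧ v ≠ t ∧ (M.fiber v).card ≤ 3 := by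
  by_contra! hc
  have h1 : M.darts.card = ∑ v ∈ M.vert, (M.fiber v).card :=
    Finset.card_eq_sum_card_fiberwise hM.base_mem
  have hts : t ∈ M.vert.erase s := Finset.mem_erase.2 ⟨hst.symm, ht⟩
  rw [← Finset.add_sum_erase _ _ hs, ← Finset.add_sum_erase _ _ hts] at h1
  have h2 := Finset.card_nsmul_le_sum ((M.vert.erase s).erase t) (fun v => (M.fiber v).card) 4
    (by
      intro v hv
      simp only [Finset.mem_erase] at hv
      have := hc v hv.2.2 hv.2.1 hv.1
      omega)
  have h4 := Finset.card_erase_of_mem hs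
  have h5 := Finset.card_erase_of_mem hts
  have := hM.two_le_card_fiber h3 hs
  have := hM.two_le_card_fiber h3 ht
  have := hM.card_darts
  rw [smul_eq_mul] at h2
  omega

/-- Absence of parallel edges is not an axiom of `IsLaman`; it follows from sparsity of the
two-element set of endpoints, which allows only two darts. -/
theorem eq_of_base_eq {d e : D} (hd : d ∈ M.darts) (he : e ∈ M.darts)
    (h : M.base d = M.base e) (h' : M.base (M.opp d) = M.base (M.opp e)) : d = e := by
  by_contra hne
  have hl := hM.base_opp_ne d hd
  have h1 := hM.sparse {M.base d, M.base (M.opp d)} (by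
    intro x hx
    simp only [Finset.mem_insert, Finset.mem_singleton] at hx
    rcases hx with rfl | rfl
    · exact hM.base_mem _ hd
    · exact hM.base_mem _ (hM.opp_mem _ hd)) (by rw [Finset.card_pair hl.symm])
  rw [Finset.card_pair hl.symm] at h1
  have h2 : ({d, e, M.opp d} : Finset D) ⊆ M.inner {M.base d, M.base (M.opp d)} := by
    have := hM.opp_mem d hd
    have := hM.opp_opp d hd
    intro x hx
    simp only [Finset.mem_insert, Finset.mem_singleton] at hx
    rw [mem_inner]
    rcases hx with rfl | rfl | rfl <;> simp_all
  have h3 := Finset.card_le_card h2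
  have h4 : ({d, e, M.opp d} : Finset D).card = 3 := by
    rw [Finset.card_eq_three]
    refine ⟨d, e, M.opp d, hne, ?_, ?_, rfl⟩
    · intro h5; exact hl (by rw [← h5])
    · intro h5; exact hl (by rw [← h5, ← h])
  omega

/-- A set with as many darts as sparsity allows does not contain all three neighbors of a vertex of
degree three. -/
theorem not_three_mem {v : V} (hv : v ∈ M.vert) {p q r : D} (hpq : p ≠ q) (hpr : p ≠ r)
    (hqr : q ≠ r) (hp : p ∈ M.fiber v) (hq : q ∈ M.fiber v) (hr : r ∈ M.fiber v)
    {X : Finset V} (hX : X ⊆ M.vert.erase v) (hc : 2 ≤ X.card)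
    (h1 : M.base (M.opp p) ∈ X) (h2 : M.base (M.opp q) ∈ X) (h3 : M.base (M.opp r) ∈ X) :
    (M.inner X).card + 8 ≤ 4 * X.card := by
  have hvX : v ∉ X := fun h => by simpa using hX h
  rw [mem_fiber] at hp hq hr
  -- Adjoining `v` adds one vertex, hence `4` to the bound, but at least six darts; so `X` itself
  -- must have slack two.
  have hs := hM.sparse (insert v X) (by
    intro x hx
    rcases Finset.mem_insert.1 hx with rfl | hx
    · exact hv
    · exact Finset.mem_of_mem_erase (hX hx)) (by rw [Finset.card_insert_of_notMem hvX]; omega)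
  rw [Finset.card_insert_of_notMem hvX] at hs
  have hsub : M.inner X ∪ ({p, q, r} ∪ ({p, q, r} : Finset D).image M.opp) ⊆
      M.inner (insert v X) := by
    refine Finset.union_subset (inner_mono (Finset.subset_insert _ _)) ?_
    intro d hd
    have := hM.opp_opp p hp.1
    have := hM.opp_opp q hq.1
    have := hM.opp_opp r hr.1
    have := hM.opp_mem p hp.1
    have := hM.opp_mem q hq.1
    have := hM.opp_mem r hr.1
    simp only [Finset.mem_union, Finset.mem_insert, Finset.mem_singleton, Finset.image_insert,
      Finset.image_singleton] at hd
    rw [mem_inner]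
    simp only [Finset.mem_insert]
    rcases hd with (rfl | rfl | rfl) | (rfl | rfl | rfl) <;> simp_all
  have hcard := Finset.card_le_card hsub
  have hthree : ({p, q, r} : Finset D).card = 3 := Finset.card_eq_three.2 ⟨p, q, r, hpq, hpr, hqr, rfl⟩
  have hmem : ∀ d ∈ ({p, q, r} : Finset D), d ∈ M.darts ∧ M.base d = v := by
    intro d hd
    simp only [Finset.mem_insert, Finset.mem_singleton] at hd
    rcases hd with rfl | rfl | rfl <;> assumption
  rw [Finset.card_union_of_disjoint, Finset.card_union_of_disjoint, Finset.card_image_of_injOn,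
    hthree] at hcard
  · omega
  · intro d hd e he h
    rw [← hM.opp_opp d (hmem d hd).1, ← hM.opp_opp e (hmem e he).1]
    exact congrArg _ h
  · rw [Finset.disjoint_left]
    intro d hd hd'
    obtain ⟨e, he, rfl⟩ := Finset.mem_image.1 hd'
    have := hM.base_opp_ne e (hmem e he).1
    rw [(hmem e he).2, (hmem _ hd).2] at this
    exact this rfl
  · rw [Finset.disjoint_left]
    intro d hd hd'
    rw [mem_inner] at hd
    rcases Finset.mem_union.1 hd' with h | h
    · rw [(hmem d h).2] at hd
      exact hvX hd.2.1
    · obtain ⟨e, he, rfl⟩ := Finset.mem_image.1 h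
      rw [hM.opp_opp e (hmem e he).1, (hmem e he).2] at hd
      exact hvX hd.2.2

/-- Two tight sets whose union is not tight share at most one vertex. -/
theorem card_inter_le_one {v : V} {X Y : Finset V} (hX : X ⊆ M.vert.erase v)
    (h1 : 4 * X.card ≤ (M.inner X).card + 6)
    (h2 : 4 * Y.card ≤ (M.inner Y).card + 6)
    (h3 : (M.inner (X ∪ Y)).card + 8 ≤ 4 * (X ∪ Y).card) : (X ∩ Y).card ≤ 1 := by
  by_contra! h
  -- The inner dart count is supermodular. With two common vertices, the slack two of the union
  -- would contradict tightness of `X` and `Y`.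
  have ha := hM.sparse (X ∩ Y) (fun x hx =>
    Finset.mem_of_mem_erase (hX (Finset.mem_of_mem_inter_left hx))) h
  have hb := Finset.card_union_add_card_inter X Y
  have hc := Finset.card_union_add_card_inter (M.inner X) (M.inner Y)
  rw [inner_inter] at hc
  have hd := Finset.card_le_card (Finset.union_subset
    (inner_mono (M := M) (Finset.subset_union_left (s₁ := X) (s₂ := Y)))
    (inner_mono Finset.subset_union_right))
  omega

/-- Suppose each pair of neighbors lies in a tight set avoiding `v`. A union of two of these sets
contains all three neighbors, so it is not tight, and the sets pairwise meet in a single vertex.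
Their inner darts are then disjoint, and their union has at most `|X| + |Y| + |Z| - 3` vertices. As
`3 · 6 = 4 · 3 + 6`, the union of all three would be tight, which is impossible since it contains
all three neighbors. -/
theorem exists_not_tight {v : V} (hv : v ∈ M.vert) {p q r : D} (hpq : p ≠ q) (hpr : p ≠ r)
    (hqr : q ≠ r) (hp : p ∈ M.fiber v) (hq : q ∈ M.fiber v) (hr : r ∈ M.fiber v) :
    (∀ X ⊆ M.vert.erase v, M.base (M.opp p) ∈ X → M.base (M.opp q) ∈ X →
      (M.inner X).card + 8 ≤ 4 * X.card) ∨
    (∀ X ⊆ M.vert.erase v, M.base (M.opp p) ∈ X → M.base (M.opp r) ∈ X →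
      (M.inner X).card + 8 ≤ 4 * X.card) ∨
    (∀ X ⊆ M.vert.erase v, M.base (M.opp q) ∈ X → M.base (M.opp r) ∈ X →
      (M.inner X).card + 8 ≤ 4 * X.card) := by
  have hne : ∀ d ∈ M.fiber v, ∀ e ∈ M.fiber v, d ≠ e → M.base (M.opp d) ≠ M.base (M.opp e) := by
    intro d hd e he hde h
    rw [mem_fiber] at hd he
    exact hde (hM.eq_of_base_eq hd.1 he.1 (hd.2.trans he.2.symm) h)
  have hab := hne p hp q hq hpq
  have hac := hne p hp r hr hpr
  have hbc := hne q hq r hr hqr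
  have key := fun X hX hc => hM.not_three_mem hv hpq hpr hqr hp hq hr (X := X) hX hc
  set a := M.base (M.opp p)
  set b := M.base (M.opp q)
  set c := M.base (M.opp r)
  have tight : ∀ X : Finset V, 4 * X.card < (M.inner X).card + 8 →
      4 * X.card ≤ (M.inner X).card + 6 := by
    intro X h
    obtain ⟨k, hk⟩ := hM.even_card_inner X
    omega
  have two : ∀ (X : Finset V) (x y : V), x ∈ X → y ∈ X → x ≠ y → 2 ≤ X.card :=
    fun X x y hx hy h => Finset.one_lt_card.2 ⟨x, hx, y, hy, h⟩
  by_contra! hcon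
  obtain ⟨⟨X, hX, haX, hbX, htX⟩, ⟨Y, hY, haY, hcY, htY⟩, ⟨Z, hZ, hbZ, hcZ, htZ⟩⟩ := hcon
  have hXY := hM.card_inter_le_one hX (tight X htX) (tight Y htY)
    (key _ (Finset.union_subset hX hY)
      (two _ a b (by simp [haX]) (by simp [hbX]) hab)
      (by simp [haX]) (by simp [hbX]) (by simp [hcY]))
  have hXZ := hM.card_inter_le_one hX (tight X htX) (tight Z htZ)
    (key _ (Finset.union_subset hX hZ)
      (two _ a b (by simp [haX]) (by simp [hbX]) hab)
      (by simp [haX]) (by simp [hbX]) (by simp [hcZ]))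
  have hYZ := hM.card_inter_le_one hY (tight Y htY) (tight Z htZ)
    (key _ (Finset.union_subset hY hZ)
      (two _ a b (by simp [haY]) (by simp [hbZ]) hab)
      (by simp [haY]) (by simp [hbZ]) (by simp [hcY]))
  have hU := key (X ∪ Y ∪ Z) (Finset.union_subset (Finset.union_subset hX hY) hZ)
      (two _ a b (by simp [haX]) (by simp [hbX]) hab)
      (by simp [haX]) (by simp [hbX]) (by simp [hcY])
  have hd : ∀ X Y : Finset V, (X ∩ Y).card ≤ 1 → Disjoint (M.inner X) (M.inner Y) := by
    intro X Y h
    rw [Finset.disjoint_iff_inter_eq_empty, inner_inter]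
    exact hM.inner_card_le_one h
  have hsub : M.inner X ∪ M.inner Y ∪ M.inner Z ⊆ M.inner (X ∪ Y ∪ Z) := by
    refine Finset.union_subset (Finset.union_subset ?_ ?_) ?_ <;> apply inner_mono
    · exact Finset.subset_union_left.trans Finset.subset_union_left
    · exact Finset.subset_union_right.trans Finset.subset_union_left
    · exact Finset.subset_union_right
  have h1 := Finset.card_le_card hsub
  rw [Finset.card_union_of_disjoint (Finset.disjoint_union_left.2 ⟨hd _ _ hXZ, hd _ _ hYZ⟩),
    Finset.card_union_of_disjoint (hd _ _ hXY)] at h1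
  have h2 := Finset.card_union_add_card_inter X Y
  have h3 := Finset.card_union_add_card_inter (X ∪ Y) Z
  have h4 : 2 ≤ ((X ∪ Y) ∩ Z).card :=
    two _ b c (by simp [hbX, hbZ]) (by simp [hcY, hcZ]) hbc
  have h5 : 1 ≤ (X ∩ Y).card := Finset.card_pos.2 ⟨a, by simp [haX, haY]⟩
  have := tight X htX
  have := tight Y htY
  have := tight Z htZ
  omega

end IsLaman

/-! ### Reverse Henneberg moves preserve the Laman property -/

/-- Deletion of a vertex `v` with just two darts `p` and `q`. -/
def deleteTwo (M : DartSystem V D) (v : V) (p q : D) : DartSystem V D where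
  vert := M.vert.erase v
  darts := M.darts \ {p, q, M.opp p, M.opp q}
  base := M.base
  opp := M.opp
  cw := skip (skip M.cw (M.opp p)) (M.opp q)

/-- Deletion of a vertex `v` with just three darts `p`, `q`, `r`, followed by the insertion of an
edge between the neighbors reached by `p` and `q`. -/
def deleteThree (M : DartSystem V D) (v : V) (p q r : D) : DartSystem V D where
  vert := M.vert.erase v
  darts := M.darts \ {p, q, r, M.opp r}
  base := M.base
  opp := fun x => if x = M.opp p then M.opp q else if x = M.opp q then M.opp p else M.opp x
  cw := skip M.cw (M.opp r)

namespace IsLaman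

variable (hM : M.IsLaman)
include hM

theorem cw_eq_of_fiber_two {v : V} {p q : D} (hpq : p ≠ q) (hf : M.fiber v = {p, q}) :
    M.cw p = q := by
  have hp : p ∈ M.fiber v := by simp [hf]
  have hq : q ∈ M.fiber v := by simp [hf]
  have hcp : M.cw p ∈ M.fiber v := by
    rw [mem_fiber] at hp ⊢
    exact ⟨hM.cw_mem p hp.1, (hM.base_cw p hp.1).trans hp.2⟩
  rw [mem_fiber] at hp hq
  rw [hf, Finset.mem_insert, Finset.mem_singleton] at hcp
  refine hcp.resolve_left fun h => hpq ?_
  have := hM.cw_trans {p} (by rintro x - rfl; exact h) p hp.1 q hq.1 (hp.2.trans hq.2.symm) rfl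
  exact (Set.mem_singleton_iff.1 this).symm

/-- Three darts have only two cyclic orders, and exchanging `p` and `q` swaps them. The extension
step may therefore fix one orientation. -/
theorem cw_eq_of_fiber_three {v : V} {p q r : D} (hpq : p ≠ q) (hpr : p ≠ r) (hqr : q ≠ r)
    (hf : M.fiber v = {p, q, r}) :
    (M.cw q = p ∧ M.cw r = q ∧ M.cw p = r) ∨ (M.cw p = q ∧ M.cw r = p ∧ M.cw q = r) := by
  have mem : ∀ x, x ∈ M.fiber v ↔ x = p ∨ x = q ∨ x = r := by simp [hf]
  have hcw : ∀ x ∈ M.fiber v, M.cw x ∈ M.fiber v := by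
    intro x hx
    rw [mem_fiber] at hx ⊢
    exact ⟨hM.cw_mem x hx.1, (hM.base_cw x hx.1).trans hx.2⟩
  have hp : p ∈ M.fiber v := by simp [mem]
  have hq : q ∈ M.fiber v := by simp [mem]
  have hr : r ∈ M.fiber v := by simp [mem]
  have trans : ∀ x ∈ M.fiber v, ∀ y ∈ M.fiber v, ∀ S : Set D, (∀ z ∈ S, M.cw z ∈ S) → x ∈ S → y ∈ S := by
    intro x hx y hy S hS h
    rw [mem_fiber] at hx hy
    exact hM.cw_trans S (fun z _ => hS z) x hx.1 y hy.1 (hx.2.trans hy.2.symm) h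
  have one : ∀ x ∈ M.fiber v, ∀ y ∈ M.fiber v, x ≠ y → M.cw x ≠ x := by
    intro x hx y hy hxy h
    have := trans x hx y hy {x} (by simpa using h) rfl
    exact hxy (Set.mem_singleton_iff.1 this).symm
  have two : ∀ x ∈ M.fiber v, ∀ y ∈ M.fiber v, ∀ z ∈ M.fiber v, x ≠ z → y ≠ z →
      M.cw x = y → M.cw y ≠ x := by
    intro x hx y hy z hz hxz hyz h h'
    have := trans x hx z hz {x, y} (by simp [h, h']) (by simp)
    simp only [Set.mem_insert_iff, Set.mem_singleton_iff] at this
    rcases this with h | h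
    · exact hxz h.symm
    · exact hyz h.symm
  have h1 := (mem _).1 (hcw p hp)
  have h2 := (mem _).1 (hcw q hq)
  have h3 := (mem _).1 (hcw r hr)
  have := one p hp q hq hpq
  have := one q hq r hr hqr
  have := one r hr p hp hpr.symm
  have := two p hp q hq r hr hpr hqr
  have := two q hq r hr p hp hpq.symm hpr.symm
  have := two p hp r hr q hq hpq hqr.symm
  grind

section DeleteTwo

variable (h3 : 3 ≤ M.vert.card) {v : V} {p q : D} (hpq : p ≠ q)
  (hf : M.fiber v = {p, q})
include h3 hpq hf

theorem deleteTwo (hv : v ∈ M.vert) : (M.deleteTwo v p q).IsLaman := by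
  have mem : ∀ x, x ∈ M.darts ∧ M.base x = v ↔ x = p ∨ x = q := by
    intro x; rw [← mem_fiber, hf]; simp
  have hp := (mem p).2 (Or.inl rfl)
  have hq := (mem q).2 (Or.inr rfl)
  have hab : M.base (M.opp p) ≠ M.base (M.opp q) := fun h =>
    hpq (hM.eq_of_base_eq hp.1 hq.1 (hp.2.trans hq.2.symm) h)
  have hpl := hM.base_opp_ne p hp.1
  have hql := hM.base_opp_ne q hq.1
  have hpo := hM.opp_opp p hp.1
  have hqo := hM.opp_opp q hq.1
  have hpm := hM.opp_mem p hp.1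
  have hqm := hM.opp_mem q hq.1
  have hcp := hM.cw_ne h3 hpm
  have hcq := hM.cw_ne h3 hqm
  have hbp := hM.base_cw _ hpm
  have hbq := hM.base_cw _ hqm
  have hmp := hM.cw_mem _ hpm
  have hmq := hM.cw_mem _ hqm
  obtain ⟨base_mem, opp_mem, opp_opp, base_opp_ne, cw_mem, base_cw, cw_trans, card_darts, sparse⟩ := hM
  have memD : ∀ x, x ∈ M.darts \ {p, q, M.opp p, M.opp q} ↔
      x ∈ M.darts ∧ M.base x ≠ v ∧ x ≠ M.opp p ∧ x ≠ M.opp q := by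
    intro x
    have := mem x
    simp only [Finset.mem_sdiff, Finset.mem_insert, Finset.mem_singleton]
    grind
  constructor
  · intro d hd
    have hd' := (memD d).1 hd
    exact Finset.mem_erase.2 ⟨hd'.2.1, base_mem d hd'.1⟩
  · intro d hd
    have hd := (memD d).1 hd
    refine (memD _).2 ?_
    have := mem (M.opp d)
    have := opp_mem d hd.1
    have := opp_opp d hd.1
    simp only [DartSystem.deleteTwo]
    clear memD cw_trans sparse mem
    grind
  · intro d hd
    exact opp_opp d ((memD d).1 hd).1
  · intro d hd
    exact base_opp_ne d ((memD d).1 hd).1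
  · intro d hd
    have hd' := (memD d).1 hd
    refine (memD _).2 ?_
    simp only [DartSystem.deleteTwo, skip]
    have := cw_mem d hd'.1
    have := base_cw d hd'.1
    clear memD cw_trans sparse mem
    grind
  · intro d hd
    have hd' := (memD d).1 hd
    simp only [DartSystem.deleteTwo, skip]
    have := cw_mem d hd'.1
    have := base_cw d hd'.1
    clear memD cw_trans sparse mem
    grind
  · intro S hS d hd e he hde hdS
    have hd := (memD d).1 hd
    have he := (memD e).1 he
    have hS' : ∀ x, x ∈ M.darts ∧ M.base x ≠ v ∧ x ≠ M.opp p ∧ x ≠ M.opp q → x ∈ S →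
      skip (skip M.cw (M.opp p)) (M.opp q) x ∈ S := fun x hx => hS x ((memD x).2 hx)
    -- To apply transitivity in the large system, each deleted dart at a neighbor joins the set
    -- exactly when its successor lies in `S`, and all darts at `v` join freely.
    have := cw_trans {x | M.base x = v ∨ (x = M.opp p ∧ M.cw (M.opp p) ∈ S) ∨
      (x = M.opp q ∧ M.cw (M.opp q) ∈ S) ∨ (x ≠ M.opp p ∧ x ≠ M.opp q ∧ x ∈ S)} (by
        intro x hx hxS
        simp only [Set.mem_ofPred_eq] at hxS ⊢
        have h1 := hS' x
        have h2 := cw_mem x hx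
        have h3 := base_cw x hx
        simp only [skip] at h1
        clear memD cw_trans sparse mem hS' hS cw_mem base_cw opp_mem opp_opp base_opp_ne base_mem
        grind) d hd.1 e he.1 hde (by simp only [Set.mem_ofPred_eq]; tauto)
    simp only [Set.mem_ofPred_eq] at this
    tauto
  · have h1 : ({p, q, M.opp p, M.opp q} : Finset D).card = 4 := by
      rw [Finset.card_insert_of_notMem, Finset.card_insert_of_notMem, Finset.card_pair]
      all_goals (try simp only [Finset.mem_insert, Finset.mem_singleton]); grind
    have h2 : ({p, q, M.opp p, M.opp q} : Finset D) ⊆ M.darts := by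
      intro x hx
      simp only [Finset.mem_insert, Finset.mem_singleton] at hx
      grind
    have h4 := Finset.card_sdiff_add_card_eq_card h2
    have h5 := Finset.card_erase_of_mem hv
    simp only [DartSystem.deleteTwo]
    omega
  · intro X hX hc
    have h1 := sparse X (hX.trans (Finset.erase_subset _ _)) hc
    have h2 : (M.deleteTwo v p q).inner X ⊆ M.inner X := by
      intro d hd
      rw [mem_inner] at hd ⊢
      exact ⟨((memD d).1 hd.1).1, hd.2⟩
    have := Finset.card_le_card h2
    omega

end DeleteTwo

section DeleteThree

variable (h3 : 3 ≤ M.vert.card) {v : V} {p q r : D} (hpq : p ≠ q) (hpr : p ≠ r) (hqr : q ≠ r)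
  (hf : M.fiber v = {p, q, r})
include h3 hpq hpr hqr hf

/-- The darts `opp p` and `opp q` survive as the two darts of the new edge, drawn along the path
through `v`. Only sets containing both of its ends gain darts, namely two, and `hX` provides that
slack. -/
theorem deleteThree (hv : v ∈ M.vert)
    (hX : ∀ X ⊆ M.vert.erase v, M.base (M.opp p) ∈ X → M.base (M.opp q) ∈ X →
      (M.inner X).card + 8 ≤ 4 * X.card) : (M.deleteThree v p q r).IsLaman := by
  have mem : ∀ x, x ∈ M.darts ∧ M.base x = v ↔ x = p ∨ x = q ∨ x = r := by
    intro x; rw [← mem_fiber, hf]; simp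
  have hp := (mem p).2 (Or.inl rfl)
  have hq := (mem q).2 (Or.inr (Or.inl rfl))
  have hr := (mem r).2 (Or.inr (Or.inr rfl))
  have hab : M.base (M.opp p) ≠ M.base (M.opp q) := fun h =>
    hpq (hM.eq_of_base_eq hp.1 hq.1 (hp.2.trans hq.2.symm) h)
  have hac : M.base (M.opp p) ≠ M.base (M.opp r) := fun h =>
    hpr (hM.eq_of_base_eq hp.1 hr.1 (hp.2.trans hr.2.symm) h)
  have hbc : M.base (M.opp q) ≠ M.base (M.opp r) := fun h =>
    hqr (hM.eq_of_base_eq hq.1 hr.1 (hq.2.trans hr.2.symm) h)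
  have hpl := hM.base_opp_ne p hp.1
  have hql := hM.base_opp_ne q hq.1
  have hrl := hM.base_opp_ne r hr.1
  have hpo := hM.opp_opp p hp.1
  have hqo := hM.opp_opp q hq.1
  have hro := hM.opp_opp r hr.1
  have hpm := hM.opp_mem p hp.1
  have hqm := hM.opp_mem q hq.1
  have hrm := hM.opp_mem r hr.1
  have hcr := hM.cw_ne h3 hrm
  have hbr := hM.base_cw _ hrm
  have hmr := hM.cw_mem _ hrm
  obtain ⟨base_mem, opp_mem, opp_opp, base_opp_ne, cw_mem, base_cw, cw_trans, card_darts, sparse⟩ := hM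
  have memD : ∀ x, x ∈ M.darts \ {p, q, r, M.opp r} ↔
      x ∈ M.darts ∧ M.base x ≠ v ∧ x ≠ M.opp r := by
    intro x
    have := mem x
    simp only [Finset.mem_sdiff, Finset.mem_insert, Finset.mem_singleton]
    grind
  constructor
  · intro d hd
    have hd' := (memD d).1 hd
    exact Finset.mem_erase.2 ⟨hd'.2.1, base_mem d hd'.1⟩
  · intro d hd
    have hd := (memD d).1 hd
    refine (memD _).2 ?_
    have := mem (M.opp d)
    have := opp_mem d hd.1
    have := opp_opp d hd.1
    clear memD cw_trans sparse mem hX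
    simp only [DartSystem.deleteThree]
    grind
  · intro d hd
    have hd' := (memD d).1 hd
    have := mem (M.opp d)
    have := opp_mem d hd'.1
    have := opp_opp d hd'.1
    clear memD cw_trans sparse mem hX
    simp only [DartSystem.deleteThree]
    grind
  · intro d hd
    have hd' := (memD d).1 hd
    have := base_opp_ne d hd'.1
    clear memD cw_trans sparse mem hX
    simp only [DartSystem.deleteThree]
    grind
  · intro d hd
    have hd' := (memD d).1 hd
    refine (memD _).2 ?_
    have := cw_mem d hd'.1
    have := base_cw d hd'.1
    clear memD cw_trans sparse mem hX
    simp only [DartSystem.deleteThree, skip]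
    grind
  · intro d hd
    have hd' := (memD d).1 hd
    have := cw_mem d hd'.1
    have := base_cw d hd'.1
    clear memD cw_trans sparse mem hX
    simp only [DartSystem.deleteThree, skip]
    grind
  · intro S hS d hd e he hde hdS
    have hd := (memD d).1 hd
    have he := (memD e).1 he
    have hS' : ∀ x, x ∈ M.darts ∧ M.base x ≠ v ∧ x ≠ M.opp r → x ∈ S →
      skip M.cw (M.opp r) x ∈ S := fun x hx => hS x ((memD x).2 hx)
    have := cw_trans {x | M.base x = v ∨ (x = M.opp r ∧ M.cw (M.opp r) ∈ S) ∨
      (x ≠ M.opp r ∧ x ∈ S)} (by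
        intro x hx hxS
        simp only [Set.mem_ofPred_eq] at hxS ⊢
        have h1 := hS' x
        have h2 := cw_mem x hx
        have h3 := base_cw x hx
        simp only [skip] at h1
        clear memD cw_trans sparse mem hS' hS cw_mem base_cw opp_mem opp_opp base_opp_ne base_mem hX
        grind) d hd.1 e he.1 hde (by simp only [Set.mem_ofPred_eq]; tauto)
    simp only [Set.mem_ofPred_eq] at this
    tauto
  · have h1 : ({p, q, r, M.opp r} : Finset D).card = 4 := by
      rw [Finset.card_insert_of_notMem, Finset.card_insert_of_notMem, Finset.card_pair]
      all_goals (try simp only [Finset.mem_insert, Finset.mem_singleton]); grind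
    have h2 : ({p, q, r, M.opp r} : Finset D) ⊆ M.darts := by
      intro x hx
      simp only [Finset.mem_insert, Finset.mem_singleton] at hx
      grind
    have h4 := Finset.card_sdiff_add_card_eq_card h2
    have h5 := Finset.card_erase_of_mem hv
    simp only [DartSystem.deleteThree]
    omega
  · intro X hXv hc
    have h1 := sparse X (hXv.trans (Finset.erase_subset _ _)) hc
    have h0 : ∀ d ∈ (M.deleteThree v p q r).inner X, d ∈ M.inner X ∨
        (M.base (M.opp p) ∈ X ∧ M.base (M.opp q) ∈ X ∧ (d = M.opp p ∨ d = M.opp q)) := by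
      intro d hd
      rw [mem_inner] at hd ⊢
      have := (memD d).1 hd.1
      simp only [DartSystem.deleteThree] at hd
      clear memD cw_trans sparse mem hX
      grind
    by_cases hin : M.base (M.opp p) ∈ X ∧ M.base (M.opp q) ∈ X
    · have h2 : (M.deleteThree v p q r).inner X ⊆ M.inner X ∪ {M.opp p, M.opp q} := by
        intro d hd
        have := h0 d hd
        simp only [Finset.mem_union, Finset.mem_insert, Finset.mem_singleton]
        tauto
      have h4 := (Finset.card_le_card h2).trans (Finset.card_union_le _ _)
      have h5 := hX X hXv hin.1 hin.2
      have h6 : ({M.opp p, M.opp q} : Finset D).card ≤ 2 := Finset.card_le_two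
      omega
    · have h2 : (M.deleteThree v p q r).inner X ⊆ M.inner X := by
        intro d hd
        have := h0 d hd
        tauto
      have := Finset.card_le_card h2
      omega

end DeleteThree

end IsLaman

/-! ### Extending labelings back over the deleted vertex -/

/-- Extension of a labeling to a new vertex with the two darts `p` and `q`. -/
def extendTwo (M : DartSystem V D) (p q : D) (ψ : D → Bool) (x : Bool) : D → Bool := fun d =>
  if d = p then x else if d = q then !x else
  if d = M.opp p then ψ (M.cw (M.opp p)) else if d = M.opp q then ψ (M.cw (M.opp q)) else ψ d

/-- Extension of a labeling to a new vertex with the three darts `p`, `q` and `r`. -/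
def extendThree (M : DartSystem V D) (p q r : D) (ψ : D → Bool) (x : Bool) : D → Bool := fun d =>
  if d = q then x else if d = r then !x else
  if d = p then (if ψ (M.opp p) = ψ (M.cw (M.opp p)) then x else !x) else
  if d = M.opp r then ψ (M.cw (M.opp r)) else ψ d

namespace IsLaman

variable (hM : M.IsLaman) (h3 : 3 ≤ M.vert.card)
include hM h3

section ExtendTwo

variable {v : V} {p q : D} (hpq : p ≠ q) (hf : M.fiber v = {p, q})
include hpq hf

/-- A new monochromatic closed set must contain an angle at `v`. If it contains `p`, its color is
both the label of `p` and the old label of the angle after `p`, so `p` can be to blame for only one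
value of `x`; likewise `q`. If `p` is to blame for one value and `q` for the other, the two colors
agree because the labels of `p` and `q` are opposite, and the two sets merge into a forbidden set of
the smaller system. -/
theorem exists_face_extendTwo {ψ : D → Bool}
    (hψ : ∀ c S, ¬ (M.deleteTwo v p q).IsMonoClosed ψ c S) :
    ∃ x, ∀ c S, ¬ M.IsMonoClosed (M.extendTwo p q ψ x) c S := by
  have mem : ∀ x, x ∈ M.darts ∧ M.base x = v ↔ x = p ∨ x = q := by
    intro x; rw [← mem_fiber, hf]; simp
  have hp := (mem p).2 (Or.inl rfl)
  have hq := (mem q).2 (Or.inr rfl)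
  have hab : M.base (M.opp p) ≠ M.base (M.opp q) := fun h =>
    hpq (hM.eq_of_base_eq hp.1 hq.1 (hp.2.trans hq.2.symm) h)
  have hpl := hM.base_opp_ne p hp.1
  have hql := hM.base_opp_ne q hq.1
  have hpo := hM.opp_opp p hp.1
  have hqo := hM.opp_opp q hq.1
  have hcwp := hM.cw_eq_of_fiber_two hpq hf
  have hcwq := hM.cw_eq_of_fiber_two hpq.symm (by rw [hf, Finset.pair_comm])
  have hcp := hM.cw_ne h3 (hM.opp_mem p hp.1)
  have hcq := hM.cw_ne h3 (hM.opp_mem q hq.1)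
  have hbp := hM.base_cw _ (hM.opp_mem p hp.1)
  have hbq := hM.base_cw _ (hM.opp_mem q hq.1)
  have memD : ∀ x, x ∈ (M.deleteTwo v p q).darts ↔
      x ∈ M.darts ∧ x ≠ p ∧ x ≠ q ∧ x ≠ M.opp p ∧ x ≠ M.opp q := by
    intro x
    simp [DartSystem.deleteTwo]
  have hext : ∀ x d, d ≠ p → d ≠ q → d ≠ M.opp p → d ≠ M.opp q → M.extendTwo p q ψ x d = ψ d := by
    intro x d h1 h2 h3 h4
    simp [extendTwo, *]
  have hextp : ∀ x, M.extendTwo p q ψ x p = x := by simp [extendTwo]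
  have hextq : ∀ x, M.extendTwo p q ψ x q = !x := by simp [extendTwo, hpq.symm]
  have hcwp_ext : ∀ x, M.extendTwo p q ψ x (M.cw (M.opp p)) = ψ (M.cw (M.opp p)) := fun x =>
    hext x _ (by grind) (by grind) hcp (by grind)
  have hcwq_ext : ∀ x, M.extendTwo p q ψ x (M.cw (M.opp q)) = ψ (M.cw (M.opp q)) := fun x =>
    hext x _ (by grind) (by grind) (by grind) hcq
  have new_mem : ∀ x c S, M.IsMonoClosed (M.extendTwo p q ψ x) c S → p ∈ S ∨ q ∈ S := by
    intro x c S hS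
    by_contra! hcon
    have h1 : M.opp p ∉ S := fun h => hcon.2 (by simpa [hpo, hcwp] using hS.closed _ h)
    have h2 : M.opp q ∉ S := fun h => hcon.1 (by simpa [hqo, hcwq] using hS.closed _ h)
    have hmem : ∀ d ∈ S, d ≠ p ∧ d ≠ q ∧ d ≠ M.opp p ∧ d ≠ M.opp q := by
      intro d hd
      refine ⟨?_, ?_, ?_, ?_⟩ <;> rintro rfl <;> tauto
    refine hψ c S ⟨fun d hd => (memD d).2 ⟨hS.mem_darts d hd, hmem d hd⟩, hS.nonempty, ?_, ?_⟩
    · intro d hd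
      have h := hS.closed d hd
      have := hmem _ h
      simpa [DartSystem.deleteTwo, skip, this] using h
    · intro d hd
      rw [← hS.label d hd]
      have := hmem d hd
      exact (hext x d this.1 this.2.1 this.2.2.1 this.2.2.2).symm
  have merge : ∀ x y c S T, M.IsMonoClosed (M.extendTwo p q ψ x) c S →
      M.IsMonoClosed (M.extendTwo p q ψ y) c T → p ∈ S → q ∈ T → False := by
    intro x y c S T hS hT hpS hqT
    have hpS' := hS.closed _ hpS
    have hqT' := hT.closed _ hqT
    -- In the smaller system, a walk that would step onto `opp p` is sent to the successor of `p`,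
    -- which is in `S`; one that would step onto `opp q` is sent to the successor of `q`, which is
    -- in `T`.
    refine hψ c {d | d ∈ (M.deleteTwo v p q).darts ∧ (d ∈ S ∨ d ∈ T)} ⟨fun d hd => hd.1,
      ⟨M.cw (M.opp p), (memD _).2 ⟨hS.mem_darts _ hpS', ?_⟩, Or.inl hpS'⟩, ?_, ?_⟩
    · grind
    · rintro d ⟨hd, hdST⟩
      rw [memD] at hd
      have hS1 := hS.closed d
      have hT1 := hT.closed d
      have h1 := hM.opp_mem d hd.1
      have h2 := hM.opp_opp d hd.1
      have h4 := hM.cw_mem _ h1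
      have h5 := hM.base_cw _ h1
      have h6 := mem (M.opp d)
      have h7 := hM.cw_mem _ (hM.opp_mem p hp.1)
      have h8 := hM.cw_mem _ (hM.opp_mem q hq.1)
      simp only [Set.mem_ofPred_eq, memD]
      simp only [DartSystem.deleteTwo, skip]
      clear memD hext mem hψ new_mem hcwp_ext hcwq_ext hextp hextq
      grind
    · rintro d ⟨hd, hdST⟩
      rw [memD] at hd
      rcases hdST with h | h
      · rw [← hS.label d h, hext x d hd.2.1 hd.2.2.1 hd.2.2.2.1 hd.2.2.2.2]
      · rw [← hT.label d h, hext y d hd.2.1 hd.2.2.1 hd.2.2.2.1 hd.2.2.2.2]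
  by_contra! hcon
  obtain ⟨c, S, hS⟩ := hcon false
  obtain ⟨c', T, hT⟩ := hcon true
  have hSp : p ∈ S → c = false ∧ ψ (M.cw (M.opp p)) = c := fun h =>
    ⟨by rw [← hS.label _ h, hextp], by rw [← hS.label _ (hS.closed _ h), hcwp_ext]⟩
  have hSq : q ∈ S → c = true ∧ ψ (M.cw (M.opp q)) = c := fun h =>
    ⟨by rw [← hS.label _ h, hextq]; rfl, by rw [← hS.label _ (hS.closed _ h), hcwq_ext]⟩
  have hTp : p ∈ T → c' = true ∧ ψ (M.cw (M.opp p)) = c' := fun h =>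
    ⟨by rw [← hT.label _ h, hextp], by rw [← hT.label _ (hT.closed _ h), hcwp_ext]⟩
  have hTq : q ∈ T → c' = false ∧ ψ (M.cw (M.opp q)) = c' := fun h =>
    ⟨by rw [← hT.label _ h, hextq]; rfl, by rw [← hT.label _ (hT.closed _ h), hcwq_ext]⟩
  rcases new_mem _ _ _ hS with h | h <;> rcases new_mem _ _ _ hT with h' | h'
  · have := hSp h; have := hTp h'; simp_all
  · obtain rfl : c = c' := (hSp h).1.trans (hTq h').1.symm
    exact merge _ _ _ _ _ hS hT h h'
  · obtain rfl : c = c' := (hSq h).1.trans (hTp h').1.symm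
    exact merge _ _ _ _ _ hT hS h' h
  · have := hSq h; have := hTq h'; simp_all

/-- Each new edge splits an old angle at the neighbor into two equal labels, while the two labels at
`v` differ. This gives the edge rule for both new edges, whatever `x` is. -/
theorem exists_isLabeling_of_deleteTwo {s t : V} (hvs : v ≠ s) (hvt : v ≠ t)
    {ψ : D → Bool} (hψ : (M.deleteTwo v p q).IsLabeling ψ s t) :
    ∃ φ, M.IsLabeling φ s t := by
  obtain ⟨x, hx⟩ := hM.exists_face_extendTwo h3 hpq hf hψ.face
  refine ⟨M.extendTwo p q ψ x, ?_⟩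
  have mem : ∀ x, x ∈ M.darts ∧ M.base x = v ↔ x = p ∨ x = q := by
    intro x; rw [← mem_fiber, hf]; simp
  have hp := (mem p).2 (Or.inl rfl)
  have hq := (mem q).2 (Or.inr rfl)
  have hab : M.base (M.opp p) ≠ M.base (M.opp q) := fun h =>
    hpq (hM.eq_of_base_eq hp.1 hq.1 (hp.2.trans hq.2.symm) h)
  have hpl := hM.base_opp_ne p hp.1
  have hql := hM.base_opp_ne q hq.1
  have hpo := hM.opp_opp p hp.1
  have hqo := hM.opp_opp q hq.1
  have hpm := hM.opp_mem p hp.1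
  have hqm := hM.opp_mem q hq.1
  have hcwp := hM.cw_eq_of_fiber_two hpq hf
  have hcwq := hM.cw_eq_of_fiber_two hpq.symm (by rw [hf, Finset.pair_comm])
  have hcp := hM.cw_ne h3 hpm
  have hcq := hM.cw_ne h3 hqm
  have hbp := hM.base_cw _ hpm
  have hbq := hM.base_cw _ hqm
  have hmp := hM.cw_mem _ hpm
  have hmq := hM.cw_mem _ hqm
  have memD : ∀ d, d ∈ (M.deleteTwo v p q).darts ↔
      d ∈ M.darts ∧ d ≠ p ∧ d ≠ q ∧ d ≠ M.opp p ∧ d ≠ M.opp q := by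
    intro d
    simp [DartSystem.deleteTwo]
  have hext : ∀ d ∈ (M.deleteTwo v p q).darts, M.extendTwo p q ψ x d = ψ d := by
    intro d hd
    rw [memD] at hd
    simp [extendTwo, hd]
  have hextp : M.extendTwo p q ψ x p = x := by simp [extendTwo]
  have hextq : M.extendTwo p q ψ x q = !x := by simp [extendTwo, hpq.symm]
  have hmp' : M.cw (M.opp p) ∈ (M.deleteTwo v p q).darts := (memD _).2 (by grind)
  have hmq' : M.cw (M.opp q) ∈ (M.deleteTwo v p q).darts := (memD _).2 (by grind)
  have hext_op : M.extendTwo p q ψ x (M.opp p) = ψ (M.cw (M.opp p)) := by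
    have h1 : M.opp p ≠ p := by grind
    have h2 : M.opp p ≠ q := by grind
    simp [extendTwo, h1, h2]
  have hext_oq : M.extendTwo p q ψ x (M.opp q) = ψ (M.cw (M.opp q)) := by
    have h1 : M.opp q ≠ p := by grind
    have h2 : M.opp q ≠ q := by grind
    have h3 : M.opp q ≠ M.opp p := by grind
    simp [extendTwo, h1, h2, h3]
  have hext_cw : ∀ d ∈ (M.deleteTwo v p q).darts,
      M.extendTwo p q ψ x (M.cw d) = ψ ((M.deleteTwo v p q).cw d) := by
    intro d hd
    rw [memD] at hd
    have h1 := hM.cw_mem d hd.1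
    have h2 := hM.base_cw d hd.1
    have h4 := mem d
    by_cases ha : M.cw d = M.opp p
    · have : M.cw (M.opp p) ≠ M.opp q := by grind
      simp [DartSystem.deleteTwo, skip, ha, hext_op, this]
    by_cases hb : M.cw d = M.opp q
    · have : M.cw (M.opp q) ≠ M.opp p := by grind
      simp [DartSystem.deleteTwo, skip, hb, hext_oq, this]
      grind
    · rw [hext _ ((memD _).2 ⟨h1, by grind, by grind, ha, hb⟩)]
      simp [DartSystem.deleteTwo, skip, ha, hb]
  have hcases : ∀ d ∈ M.darts, d = p ∨ d = q ∨ d = M.opp p ∨ d = M.opp q ∨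
      d ∈ (M.deleteTwo v p q).darts := by
    intro d hd
    rw [memD]
    tauto
  have hpside : ∀ y, M.base (M.opp p) = y → ∀ b, (∀ d ∈ (M.deleteTwo v p q).darts,
      (M.deleteTwo v p q).base d = y → ψ d = b) → M.extendTwo p q ψ x (M.opp p) = b :=
    fun y hy b hb => hext_op.trans (hb _ hmp' (hbp.trans hy))
  have hqside : ∀ y, M.base (M.opp q) = y → ∀ b, (∀ d ∈ (M.deleteTwo v p q).darts,
      (M.deleteTwo v p q).base d = y → ψ d = b) → M.extendTwo p q ψ x (M.opp q) = b :=
    fun y hy b hb => hext_oq.trans (hb _ hmq' (hbq.trans hy))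
  refine ⟨?_, ?_, ?_, ?_, hx⟩
  · intro d hd hds
    rcases hcases d hd with rfl | rfl | rfl | rfl | h
    · exact absurd (hp.2.symm.trans hds) hvs
    · exact absurd (hq.2.symm.trans hds) hvs
    · exact hpside _ hds _ hψ.label_left
    · exact hqside _ hds _ hψ.label_left
    · rw [hext d h]; exact hψ.label_left d h hds
  · intro d hd hds
    rcases hcases d hd with rfl | rfl | rfl | rfl | h
    · exact absurd (hp.2.symm.trans hds) hvt
    · exact absurd (hq.2.symm.trans hds) hvt
    · exact hpside _ hds _ hψ.label_right
    · exact hqside _ hds _ hψ.label_right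
    · rw [hext d h]; exact hψ.label_right d h hds
  · intro w hw hws hwt
    by_cases hwv : w = v
    · exact ⟨p, hp.1, q, hq.1, hp.2.trans hwv.symm, hq.2.trans hwv.symm, by
        rw [hextp, hextq]; cases x <;> decide⟩
    · obtain ⟨d, hd, e, he, h⟩ := hψ.vertex w (Finset.mem_erase.2 ⟨hwv, hw⟩) hws hwt
      refine ⟨d, ((memD d).1 hd).1, e, ((memD e).1 he).1, h.1, h.2.1, ?_⟩
      rw [hext d hd, hext e he]
      exact h.2.2
  · intro d hd hst
    have hcwop := hext _ hmp'
    have hcwoq := hext _ hmq'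
    rcases hcases d hd with rfl | rfl | rfl | rfl | h
    · rw [hcwp, hext_op, hcwop, hextp, hextq]; simp
    · rw [hcwq, hext_oq, hcwoq, hextp, hextq]; simp
    · rw [hpo, hcwp, hext_op, hcwop, hextp, hextq]; simp
    · rw [hqo, hcwq, hext_oq, hcwoq, hextp, hextq]; simp
    · have h' : M.opp d ∈ (M.deleteTwo v p q).darts := by
        rw [memD] at h ⊢
        have := hM.opp_opp d hd
        have := hM.opp_mem d hd
        clear hcases hext_cw memD
        grind
      rw [hext d h, hext _ h', hext_cw d h, hext_cw _ h']
      exact hψ.edge d h hst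

end ExtendTwo

end IsLaman

namespace IsLaman

variable (hM : M.IsLaman) (h3 : 3 ≤ M.vert.card)
include hM h3

section ExtendThree

variable {v : V} {p q r : D} (hpq : p ≠ q) (hpr : p ≠ r) (hqr : q ≠ r)
  (hf : M.fiber v = {p, q, r}) (hqp : M.cw q = p) (hrq : M.cw r = q) (hpr' : M.cw p = r)
include hpq hpr hqr hf hqp hrq hpr'

/-- The angle named `p` lies between `p` and `q`, away from `r`; reinserting `v` only puts this
angle into a face running along the inserted edge, so its label does no harm. The angles `q` and `r`
on the two sides of the dart `r` play the roles of the two angles in the case of degree two. -/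
theorem exists_face_extendThree {ψ : D → Bool}
    (hψ : ∀ c S, ¬ (M.deleteThree v p q r).IsMonoClosed ψ c S) :
    ∃ x, ∀ c S, ¬ M.IsMonoClosed (M.extendThree p q r ψ x) c S := by
  have mem : ∀ x, x ∈ M.darts ∧ M.base x = v ↔ x = p ∨ x = q ∨ x = r := by
    intro x; rw [← mem_fiber, hf]; simp
  have hp := (mem p).2 (Or.inl rfl)
  have hq := (mem q).2 (Or.inr (Or.inl rfl))
  have hr := (mem r).2 (Or.inr (Or.inr rfl))
  have hab : M.base (M.opp p) ≠ M.base (M.opp q) := fun h =>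
    hpq (hM.eq_of_base_eq hp.1 hq.1 (hp.2.trans hq.2.symm) h)
  have hac : M.base (M.opp p) ≠ M.base (M.opp r) := fun h =>
    hpr (hM.eq_of_base_eq hp.1 hr.1 (hp.2.trans hr.2.symm) h)
  have hbc : M.base (M.opp q) ≠ M.base (M.opp r) := fun h =>
    hqr (hM.eq_of_base_eq hq.1 hr.1 (hq.2.trans hr.2.symm) h)
  have hpl := hM.base_opp_ne p hp.1
  have hql := hM.base_opp_ne q hq.1
  have hrl := hM.base_opp_ne r hr.1
  have hpo := hM.opp_opp p hp.1
  have hqo := hM.opp_opp q hq.1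
  have hro := hM.opp_opp r hr.1
  have hpm := hM.opp_mem p hp.1
  have hqm := hM.opp_mem q hq.1
  have hrm := hM.opp_mem r hr.1
  have hcr := hM.cw_ne h3 hrm
  have hbp := hM.base_cw _ hpm
  have hbq := hM.base_cw _ hqm
  have hbr := hM.base_cw _ hrm
  have hmp := hM.cw_mem _ hpm
  have hmq := hM.cw_mem _ hqm
  have hmr := hM.cw_mem _ hrm
  have memD : ∀ x, x ∈ (M.deleteThree v p q r).darts ↔
      x ∈ M.darts ∧ x ≠ p ∧ x ≠ q ∧ x ≠ r ∧ x ≠ M.opp r := by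
    intro x
    simp [DartSystem.deleteThree]
  have hext : ∀ x d, d ≠ p → d ≠ q → d ≠ r → d ≠ M.opp r → M.extendThree p q r ψ x d = ψ d := by
    intro x d h1 h2 h3 h4
    simp [extendThree, *]
  have hextq : ∀ x, M.extendThree p q r ψ x q = x := by simp [extendThree]
  have hextr : ∀ x, M.extendThree p q r ψ x r = !x := by simp [extendThree, hqr.symm]
  have hcwq_ext : ∀ x, M.extendThree p q r ψ x (M.cw (M.opp q)) = ψ (M.cw (M.opp q)) := fun x =>
    hext x _ (by grind) (by grind) (by grind) (by grind)
  have hcwr_ext : ∀ x, M.extendThree p q r ψ x (M.cw (M.opp r)) = ψ (M.cw (M.opp r)) := fun x =>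
    hext x _ (by grind) (by grind) (by grind) hcr
  have new_mem : ∀ x c S, M.IsMonoClosed (M.extendThree p q r ψ x) c S → q ∈ S ∨ r ∈ S := by
    intro x c S hS
    by_contra! hcon
    have h1 : M.opp p ∉ S := fun h => hcon.2 (by simpa [hpo, hpr'] using hS.closed _ h)
    have h2 : M.opp r ∉ S := fun h => hcon.1 (by simpa [hro, hrq] using hS.closed _ h)
    have hne : ∀ d ∈ S, d ≠ q ∧ d ≠ r ∧ d ≠ M.opp p ∧ d ≠ M.opp r := by
      intro d hd
      refine ⟨?_, ?_, ?_, ?_⟩ <;> rintro rfl <;> tauto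
    -- Dropping `p` keeps the set closed, since the smaller walk passes from `opp q` directly to the
    -- successor of `p`; that successor also keeps the set nonempty.
    refine hψ c {d | d ∈ S ∧ d ≠ p} ⟨fun d hd => (memD d).2 ?_, ?_, ?_, ?_⟩
    · have := hne d hd.1
      exact ⟨hS.mem_darts d hd.1, hd.2, this.1, this.2.1, this.2.2.2⟩
    · obtain ⟨d, hd⟩ := hS.nonempty
      by_cases hdp : d = p
      · exact ⟨M.cw (M.opp p), by rw [← hdp]; exact hS.closed d hd, by grind⟩
      · exact ⟨d, hd, hdp⟩
    · rintro d ⟨hd, hdp⟩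
      have h := hS.closed d hd
      have h4 := hne d hd
      have h5 := hne _ h
      have h6 := hS.closed p
      have h7 := hM.opp_mem d (hS.mem_darts d hd)
      have h8 := hM.base_cw _ h7
      have h9 := hM.opp_opp d (hS.mem_darts d hd)
      have h10 := mem (M.opp d)
      simp only [Set.mem_ofPred_eq, DartSystem.deleteThree, skip]
      clear memD hext mem hψ hcwq_ext hcwr_ext hextq hextr hne
      grind
    · rintro d ⟨hd, hdp⟩
      rw [← hS.label d hd]
      have := hne d hd
      exact (hext x d hdp this.1 this.2.1 this.2.2.2).symm
  have merge : ∀ x y c S T, M.IsMonoClosed (M.extendThree p q r ψ x) c S →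
      M.IsMonoClosed (M.extendThree p q r ψ y) c T → q ∈ S → r ∈ T → False := by
    intro x y c S T hS hT hqS hrT
    have hqS' := hS.closed _ hqS
    have hrT' := hT.closed _ hrT
    -- A walk that would step onto `r` now follows the inserted edge to the successor of `q`, in
    -- `S`; one that would step onto `opp r` goes to the successor of `r`, in `T`.
    refine hψ c {d | d ∈ (M.deleteThree v p q r).darts ∧ (d ∈ S ∨ d ∈ T)} ⟨fun d hd => hd.1,
      ⟨M.cw (M.opp q), (memD _).2 ⟨hS.mem_darts _ hqS', ?_⟩, Or.inl hqS'⟩, ?_, ?_⟩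
    · grind
    · rintro d ⟨hd, hdST⟩
      rw [memD] at hd
      have hS1 := hS.closed d
      have hT1 := hT.closed d
      have hS2 := hS.closed p
      have hT2 := hT.closed p
      have h1 := hM.opp_mem d hd.1
      have h2 := hM.opp_opp d hd.1
      have h4 := hM.cw_mem _ h1
      have h5 := hM.base_cw _ h1
      have h6 := mem (M.opp d)
      simp only [Set.mem_ofPred_eq, memD]
      simp only [DartSystem.deleteThree, skip]
      clear memD hext mem hψ new_mem hcwq_ext hcwr_ext hextq hextr
      grind
    · rintro d ⟨hd, hdST⟩
      rw [memD] at hd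
      rcases hdST with h | h
      · rw [← hS.label d h, hext x d hd.2.1 hd.2.2.1 hd.2.2.2.1 hd.2.2.2.2]
      · rw [← hT.label d h, hext y d hd.2.1 hd.2.2.1 hd.2.2.2.1 hd.2.2.2.2]
  by_contra! hcon
  obtain ⟨c, S, hS⟩ := hcon false
  obtain ⟨c', T, hT⟩ := hcon true
  have hSq : q ∈ S → c = false ∧ ψ (M.cw (M.opp q)) = c := fun h =>
    ⟨by rw [← hS.label _ h, hextq], by rw [← hS.label _ (hS.closed _ h), hcwq_ext]⟩
  have hSr : r ∈ S → c = true ∧ ψ (M.cw (M.opp r)) = c := fun h =>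
    ⟨by rw [← hS.label _ h, hextr]; rfl, by rw [← hS.label _ (hS.closed _ h), hcwr_ext]⟩
  have hTq : q ∈ T → c' = true ∧ ψ (M.cw (M.opp q)) = c' := fun h =>
    ⟨by rw [← hT.label _ h, hextq], by rw [← hT.label _ (hT.closed _ h), hcwq_ext]⟩
  have hTr : r ∈ T → c' = false ∧ ψ (M.cw (M.opp r)) = c' := fun h =>
    ⟨by rw [← hT.label _ h, hextr]; rfl, by rw [← hT.label _ (hT.closed _ h), hcwr_ext]⟩
  rcases new_mem _ _ _ hS with h | h <;> rcases new_mem _ _ _ hT with h' | h'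
  · have := hSq h; have := hTq h'; simp_all
  · obtain rfl : c = c' := (hSq h).1.trans (hTr h').1.symm
    exact merge _ _ _ _ _ hS hT h h'
  · obtain rfl : c = c' := (hSr h).1.trans (hTq h').1.symm
    exact merge _ _ _ _ _ hT hS h' h
  · have := hSr h; have := hTr h'; simp_all

/-- The inserted edge has equal labels at exactly one end. The label of the angle `p` is chosen so
that edge `p` obeys the edge rule, and then the rule for the inserted edge gives it for edge `q`.
Edge `r` behaves as in degree two. The hypothesis `hst` makes the edge rule available for the
inserted edge. -/
theorem exists_isLabeling_of_deleteThree {s t : V} (hvs : v ≠ s) (hvt : v ≠ t)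
    (hst : ¬ ((M.base (M.opp p) = s ∨ M.base (M.opp p) = t) ∧
      (M.base (M.opp q) = s ∨ M.base (M.opp q) = t)))
    {ψ : D → Bool} (hψ : (M.deleteThree v p q r).IsLabeling ψ s t) :
    ∃ φ, M.IsLabeling φ s t := by
  obtain ⟨x, hx⟩ := hM.exists_face_extendThree h3 hpq hpr hqr hf hqp hrq hpr' hψ.face
  refine ⟨M.extendThree p q r ψ x, ?_⟩
  have mem : ∀ x, x ∈ M.darts ∧ M.base x = v ↔ x = p ∨ x = q ∨ x = r := by
    intro x; rw [← mem_fiber, hf]; simp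
  have hp := (mem p).2 (Or.inl rfl)
  have hq := (mem q).2 (Or.inr (Or.inl rfl))
  have hr := (mem r).2 (Or.inr (Or.inr rfl))
  have hab : M.base (M.opp p) ≠ M.base (M.opp q) := fun h =>
    hpq (hM.eq_of_base_eq hp.1 hq.1 (hp.2.trans hq.2.symm) h)
  have hac : M.base (M.opp p) ≠ M.base (M.opp r) := fun h =>
    hpr (hM.eq_of_base_eq hp.1 hr.1 (hp.2.trans hr.2.symm) h)
  have hbc : M.base (M.opp q) ≠ M.base (M.opp r) := fun h =>
    hqr (hM.eq_of_base_eq hq.1 hr.1 (hq.2.trans hr.2.symm) h)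
  have hpl := hM.base_opp_ne p hp.1
  have hql := hM.base_opp_ne q hq.1
  have hrl := hM.base_opp_ne r hr.1
  have hpo := hM.opp_opp p hp.1
  have hqo := hM.opp_opp q hq.1
  have hro := hM.opp_opp r hr.1
  have hpm := hM.opp_mem p hp.1
  have hqm := hM.opp_mem q hq.1
  have hrm := hM.opp_mem r hr.1
  have hcr := hM.cw_ne h3 hrm
  have hbp := hM.base_cw _ hpm
  have hbq := hM.base_cw _ hqm
  have hbr := hM.base_cw _ hrm
  have hmr := hM.cw_mem _ hrm
  have memD : ∀ d, d ∈ (M.deleteThree v p q r).darts ↔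
      d ∈ M.darts ∧ d ≠ p ∧ d ≠ q ∧ d ≠ r ∧ d ≠ M.opp r := by
    intro d
    simp [DartSystem.deleteThree]
  have hext : ∀ d ∈ (M.deleteThree v p q r).darts, M.extendThree p q r ψ x d = ψ d := by
    intro d hd
    rw [memD] at hd
    simp [extendThree, hd]
  have hextq : M.extendThree p q r ψ x q = x := by simp [extendThree]
  have hextr : M.extendThree p q r ψ x r = !x := by simp [extendThree, hqr.symm]
  have hextp : M.extendThree p q r ψ x p =
      if ψ (M.opp p) = ψ (M.cw (M.opp p)) then x else !x := by simp [extendThree, hpq, hpr]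
  have hmr' : M.cw (M.opp r) ∈ (M.deleteThree v p q r).darts := (memD _).2 (by grind)
  have hmp' : M.opp p ∈ (M.deleteThree v p q r).darts := (memD _).2 (by grind)
  have hmq' : M.opp q ∈ (M.deleteThree v p q r).darts := (memD _).2 (by grind)
  have hext_or : M.extendThree p q r ψ x (M.opp r) = ψ (M.cw (M.opp r)) := by
    have h1 : M.opp r ≠ p := by grind
    have h2 : M.opp r ≠ q := by grind
    have h3 : M.opp r ≠ r := by grind
    simp [extendThree, h1, h2, h3]
  have hext_cw : ∀ d ∈ (M.deleteThree v p q r).darts,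
      M.extendThree p q r ψ x (M.cw d) = ψ ((M.deleteThree v p q r).cw d) := by
    intro d hd
    rw [memD] at hd
    have h1 := hM.cw_mem d hd.1
    have h2 := hM.base_cw d hd.1
    have h4 := mem d
    by_cases ha : M.cw d = M.opp r
    · simp [DartSystem.deleteThree, skip, ha, hext_or]
    · rw [hext _ ((memD _).2 ⟨h1, by grind, by grind, by grind, ha⟩)]
      simp [DartSystem.deleteThree, skip, ha]
  have hcases : ∀ d ∈ M.darts, d = p ∨ d = q ∨ d = r ∨ d = M.opp r ∨
      d ∈ (M.deleteThree v p q r).darts := by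
    intro d hd
    rw [memD]
    tauto
  have hcwp : (M.deleteThree v p q r).cw (M.opp p) = M.cw (M.opp p) :=
    if_neg fun h => hac (by rw [← hbp, h])
  have hcwq : (M.deleteThree v p q r).cw (M.opp q) = M.cw (M.opp q) :=
    if_neg fun h => hbc (by rw [← hbq, h])
  have hopp : (M.deleteThree v p q r).opp (M.opp p) = M.opp q := if_pos rfl
  have hedge : ψ (M.opp p) = ψ (M.cw (M.opp p)) ↔ ψ (M.opp q) ≠ ψ (M.cw (M.opp q)) := by
    have := hψ.edge _ hmp' (by rw [hopp]; exact hst)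
    rwa [hopp, hcwp, hcwq] at this
  refine ⟨?_, ?_, ?_, ?_, hx⟩
  · intro d hd hds
    rcases hcases d hd with rfl | rfl | rfl | rfl | h
    · exact absurd (hp.2.symm.trans hds) hvs
    · exact absurd (hq.2.symm.trans hds) hvs
    · exact absurd (hr.2.symm.trans hds) hvs
    · rw [hext_or]; exact hψ.label_left _ hmr' (hbr.trans hds)
    · rw [hext d h]; exact hψ.label_left d h hds
  · intro d hd hds
    rcases hcases d hd with rfl | rfl | rfl | rfl | h
    · exact absurd (hp.2.symm.trans hds) hvt
    · exact absurd (hq.2.symm.trans hds) hvt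
    · exact absurd (hr.2.symm.trans hds) hvt
    · rw [hext_or]; exact hψ.label_right _ hmr' (hbr.trans hds)
    · rw [hext d h]; exact hψ.label_right d h hds
  · intro w hw hws hwt
    by_cases hwv : w = v
    · exact ⟨q, hq.1, r, hr.1, hq.2.trans hwv.symm, hr.2.trans hwv.symm, by
        rw [hextq, hextr]; cases x <;> decide⟩
    · obtain ⟨d, hd, e, he, h⟩ := hψ.vertex w (Finset.mem_erase.2 ⟨hwv, hw⟩) hws hwt
      refine ⟨d, ((memD d).1 hd).1, e, ((memD e).1 he).1, h.1, h.2.1, ?_⟩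
      rw [hext d hd, hext e he]
      exact h.2.2
  · have hp_edge : M.extendThree p q r ψ x p = M.extendThree p q r ψ x (M.cw p) ↔
        M.extendThree p q r ψ x (M.opp p) ≠ M.extendThree p q r ψ x (M.cw (M.opp p)) := by
      rw [hpr', hext_cw _ hmp', hext _ hmp', hcwp, hextp, hextr]
      split_ifs with h <;> simp [h]
    have hq_edge : M.extendThree p q r ψ x q = M.extendThree p q r ψ x (M.cw q) ↔
        M.extendThree p q r ψ x (M.opp q) ≠ M.extendThree p q r ψ x (M.cw (M.opp q)) := by
      rw [hqp, hext_cw _ hmq', hext _ hmq', hcwq, hextp, hextq, ← hedge]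
      split_ifs with h <;> simp [h]
    have hr_edge : M.extendThree p q r ψ x r = M.extendThree p q r ψ x (M.cw r) ↔
        M.extendThree p q r ψ x (M.opp r) ≠ M.extendThree p q r ψ x (M.cw (M.opp r)) := by
      rw [hrq, hext_or, hext _ hmr', hextq, hextr]
      simp
    intro d hd hst'
    rcases hcases d hd with rfl | rfl | rfl | rfl | h
    · exact hp_edge
    · exact hq_edge
    · exact hr_edge
    · rw [hro]; exact iff_not_comm.1 hr_edge
    by_cases hdp : d = M.opp p
    · rw [hdp, hpo]; exact iff_not_comm.1 hp_edge
    by_cases hdq : d = M.opp q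
    · rw [hdq, hqo]; exact iff_not_comm.1 hq_edge
    have hopp' : (M.deleteThree v p q r).opp d = M.opp d := by
      simp [DartSystem.deleteThree, hdp, hdq]
    have h' : M.opp d ∈ (M.deleteThree v p q r).darts := by
      rw [memD] at h ⊢
      have := hM.opp_opp d hd
      have := hM.opp_mem d hd
      clear hcases hext_cw memD
      grind
    have := hψ.edge d h (by rw [hopp']; exact hst')
    rw [hopp'] at this
    rw [hext d h, hext _ h', hext_cw d h, hext_cw _ h']
    exact this

end ExtendThree

end IsLaman

/-! ### Induction on the number of vertices -/

/-- Every edge of a Laman graph with a rotation system is the special edge of some labeling. -/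
theorem IsLaman.exists_isLabeling {M : DartSystem V D} (hM : M.IsLaman) {s t : V}
    {e : D} (he : e ∈ M.darts) (hes : M.base e = s) (het : M.base (M.opp e) = t) :
    ∃ φ, M.IsLabeling φ s t := by
  induction hn : M.vert.card generalizing M with
  | zero =>
    have := hM.base_mem e he
    rw [Finset.card_eq_zero.1 hn] at this
    simp at this
  | succ n ih =>
    have hs : s ∈ M.vert := hes ▸ hM.base_mem e he
    have ht : t ∈ M.vert := het ▸ hM.base_mem _ (hM.opp_mem e he)
    have hst : s ≠ t := by
      rw [← hes, ← het]; exact (hM.base_opp_ne e he).symm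
    by_cases h3 : 3 ≤ M.vert.card
    · obtain ⟨v, hv, hvs, hvt, hcard⟩ := hM.exists_card_fiber_le h3 hs ht hst
      have hcard' := hM.two_le_card_fiber h3 hv
      have hn' : (M.vert.erase v).card = n := by rw [Finset.card_erase_of_mem hv, hn]; rfl
      have he_ne : ∀ d ∈ M.fiber v, e ≠ d ∧ e ≠ M.opp d := by
        intro d hd
        rw [mem_fiber] at hd
        constructor
        · rintro rfl
          exact hvs (hd.2.symm.trans hes)
        · rintro rfl
          rw [hM.opp_opp d hd.1] at het
          exact hvt (hd.2.symm.trans het)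
      rcases (show (M.fiber v).card = 2 ∨ (M.fiber v).card = 3 by omega) with h | h
      · obtain ⟨p, q, hpq, hf⟩ := Finset.card_eq_two.1 h
        have h1 := he_ne p (by simp [hf])
        have h2 := he_ne q (by simp [hf])
        obtain ⟨ψ, hψ⟩ := ih (hM.deleteTwo h3 hpq hf hv)
          (by simp [DartSystem.deleteTwo, he, h1, h2]) hes het hn'
        exact hM.exists_isLabeling_of_deleteTwo h3 hpq hf hvs hvt hψ
      · have step : ∀ p q r, p ≠ q → p ≠ r → q ≠ r → M.fiber v = {p, q, r} →
            (∀ X ⊆ M.vert.erase v, M.base (M.opp p) ∈ X → M.base (M.opp q) ∈ X →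
              (M.inner X).card + 8 ≤ 4 * X.card) → M.cw q = p ∧ M.cw r = q ∧ M.cw p = r →
            ∃ φ, M.IsLabeling φ s t := by
          intro p q r hpq hpr hqr hf hX hcw
          have h1 := he_ne p (by simp [hf])
          have h2 := he_ne q (by simp [hf])
          have h4 := he_ne r (by simp [hf])
          have hp : p ∈ M.fiber v := by simp [hf]
          have hq : q ∈ M.fiber v := by simp [hf]
          rw [mem_fiber] at hp hq
          have hab : M.base (M.opp p) ≠ M.base (M.opp q) := fun h =>
            hpq (hM.eq_of_base_eq hp.1 hq.1 (hp.2.trans hq.2.symm) h)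
          -- The set `{s, t}` already contains the special edge and is tight, so `hX` excludes it:
          -- the inserted edge does not join `s` and `t`.
          have hnot : ¬ ((M.base (M.opp p) = s ∨ M.base (M.opp p) = t) ∧
              (M.base (M.opp q) = s ∨ M.base (M.opp q) = t)) := by
            rintro hc
            have := hX {s, t} (by
              intro x hx
              simp only [Finset.mem_insert, Finset.mem_singleton] at hx
              rcases hx with rfl | rfl
              · exact Finset.mem_erase.2 ⟨hvs.symm, hs⟩
              · exact Finset.mem_erase.2 ⟨hvt.symm, ht⟩)
              (by simpa using hc.1) (by simpa using hc.2)
            rw [Finset.card_pair hst] at this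
            have h5 : e ∈ M.inner {s, t} := by rw [mem_inner]; simp [he, hes, het]
            have := Finset.card_pos.2 ⟨e, h5⟩
            omega
          have hopp : (M.deleteThree v p q r).opp e = M.opp e := by
            simp [DartSystem.deleteThree, h1, h2]
          obtain ⟨ψ, hψ⟩ := ih (hM.deleteThree h3 hpq hpr hqr hf hv hX)
            (by simp [DartSystem.deleteThree, he, h1, h2, h4]) hes
            (by rw [hopp]; exact het) hn'
          exact hM.exists_isLabeling_of_deleteThree h3 hpq hpr hqr hf hcw.1 hcw.2.1 hcw.2.2
            hvs hvt hnot hψ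
        have step' : ∀ p q r, p ≠ q → p ≠ r → q ≠ r → M.fiber v = {p, q, r} →
            (∀ X ⊆ M.vert.erase v, M.base (M.opp p) ∈ X → M.base (M.opp q) ∈ X →
              (M.inner X).card + 8 ≤ 4 * X.card) → ∃ φ, M.IsLabeling φ s t := by
          intro p q r hpq hpr hqr hf hX
          rcases hM.cw_eq_of_fiber_three hpq hpr hqr hf with h | h
          · exact step p q r hpq hpr hqr hf hX h
          · exact step q p r hpq.symm hqr hpr (by rw [hf, Finset.insert_comm])
              (fun X h1 h2 h3 => hX X h1 h3 h2) h
        obtain ⟨p, q, r, hpq, hpr, hqr, hf⟩ := Finset.card_eq_three.1 h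
        rcases hM.exists_not_tight hv hpq hpr hqr (by simp [hf]) (by simp [hf]) (by simp [hf])
          with hX | hX | hX
        · exact step' p q r hpq hpr hqr hf hX
        · exact step' p r q hpr hpq hqr.symm (by rw [hf, Finset.pair_comm q r]) hX
        · exact step' q r p hqr hpq.symm hpr.symm
            (by rw [hf, Finset.insert_comm, Finset.pair_comm p r]) hX
    · have hvert : ∀ w ∈ M.vert, w = s ∨ w = t := by
        intro w hw
        have h1 : {s, t} = M.vert := Finset.eq_of_subset_of_card_le
          (by intro x; simp only [Finset.mem_insert, Finset.mem_singleton]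
              rintro (rfl | rfl) <;> assumption)
          (by rw [Finset.card_pair hst]; omega)
        simpa [← h1] using hw
      refine ⟨fun d => decide (M.base d = t), ?_, ?_, ?_, ?_, ?_⟩
      · intro d _ h; simp [h, hst]
      · intro d _ h; simp [h]
      · intro w hw h1 h2; exact absurd (hvert w hw) (by tauto)
      · intro d hd h
        exact absurd ⟨hvert _ (hM.base_mem d hd), hvert _ (hM.base_mem _ (hM.opp_mem d hd))⟩ h
      · intro c S hS
        obtain ⟨d, hd⟩ := hS.nonempty
        have hdm := hS.mem_darts d hd
        have hom := hM.opp_mem d hdm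
        have h1 := hS.label _ hd
        -- With only `s` and `t` left, each step along a face moves to the other vertex and flips
        -- the label.
        have h2 := hS.label _ (hS.closed _ hd)
        rw [hM.base_cw _ hom, ← h1] at h2
        have h4 := hvert _ (hM.base_mem d hdm)
        have h5 := hvert _ (hM.base_mem _ hom)
        have h6 := hM.base_opp_ne d hdm
        have h7 := decide_eq_decide.1 h2
        rcases h4 with h4 | h4 <;> rcases h5 with h5 | h5 <;> simp_all

end DartSystem

/-! ### Drops in cyclic 0-1 words -/

theorem Equiv.Perm.exists_descent {α : Type*} [Finite α] {p : Equiv.Perm α} {φ : α → Bool} {x y : α}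
    (h : p.SameCycle x y) (hx : φ x = true) (hy : φ y = false) :
    ∃ z, p.SameCycle x z ∧ φ z = true ∧ φ (p z) = false := by
  by_contra! hcon
  obtain ⟨n, -, rfl⟩ := h.exists_pow_eq'
  have : ∀ k : ℕ, φ ((p ^ k) x) = true := by
    intro k
    induction k with
    | zero => simpa using hx
    | succ k ih =>
      have := hcon _ ⟨k, by simp⟩ ih
      rw [pow_succ']
      simpa using this
  simp [this n] at hy

/-- Reading starts just after the unique drop `z`. Once the first `1` appears, a return to `0` would
be a drop, which cannot happen before the period closes at `z`. -/
theorem formsTwoIntervals_of_descent_unique {α : Type*} [Finite α] {p : Equiv.Perm α}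
    {φ : α → Bool} {x z : α} (hz : p.SameCycle x z) (hz1 : φ z = true) (hz0 : φ (p z) = false)
    (huniq : ∀ w, p.SameCycle x w → φ w = true → φ (p w) = false → w = z) :
    FormsTwoIntervals p (fun a => if φ a then 1 else 0) x := by
  set y := p z with hy
  have hper : y ∈ Function.periodicPts p :=
    Function.mk_mem_periodicPts (orderOf_pos p) (by
      rw [Function.IsPeriodicPt, Function.IsFixedPt, Equiv.Perm.iterate_eq_pow, pow_orderOf_eq_one]
      rfl)
  have hN := Function.minimalPeriod_pos_of_mem_periodicPts hper
  set N := Function.minimalPeriod p y with hNdef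
  have hNy : (p ^ N) y = y := by
    rw [← Equiv.Perm.iterate_eq_pow]; exact Function.iterate_minimalPeriod
  have hpred : (p ^ (N - 1)) y = z := by
    apply p.injective
    rw [← Equiv.Perm.mul_apply, ← pow_succ', Nat.sub_add_cancel hN, hNy]
  have hcyc : ∀ k : ℕ, p.SameCycle x ((p ^ k) y) := by
    intro k
    exact hz.trans ⟨k + 1, by rw [hy, ← Equiv.Perm.mul_apply, ← pow_succ]; norm_cast⟩
  have hex : ∃ k, φ ((p ^ k) y) = true := ⟨N - 1, by rw [hpred]; exact hz1⟩
  have ha1 := Nat.find_spec hex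
  have ha0 : ∀ k < Nat.find hex, φ ((p ^ k) y) = false := fun k hk => by
    simpa using Nat.find_min hex hk
  have haN : Nat.find hex ≤ N - 1 := Nat.find_min' hex (by rw [hpred]; exact hz1)
  have hapos : 0 < Nat.find hex := by
    rw [Nat.pos_iff_ne_zero]
    intro h
    rw [h] at ha1
    simp [hz0] at ha1
  generalize Nat.find hex = a at *
  refine ⟨y, by simpa using hcyc 0, a, N - a, hapos, by omega, by omega, ?_, ?_⟩
  · intro k hk
    simp [ha0 k hk]
  · intro k hk hkN
    have : φ ((p ^ k) y) = true := by
      induction k, hk using Nat.le_induction with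
      | base => exact ha1
      | succ k hk ih =>
        have ih := ih (by omega)
        by_contra hcon
        rw [Bool.not_eq_true, pow_succ', Equiv.Perm.mul_apply] at hcon
        have h1 := huniq _ (hcyc k) ih hcon
        rw [← hpred, ← Equiv.Perm.iterate_eq_pow, ← Equiv.Perm.iterate_eq_pow] at h1
        have := Function.iterate_injOn_Iio_minimalPeriod (f := p) (x := y)
          (Set.mem_Iio.2 (by omega)) (Set.mem_Iio.2 (by omega)) h1
        omega
    simp [this]

/-- Around the cycles of a permutation, as many labels drop as labels rise. -/
theorem card_change_eq_two_mul_card_descent {α : Type*} [Fintype α] (p : Equiv.Perm α)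
    (φ : α → Bool) :
    (Finset.univ.filter fun x => φ x ≠ φ (p x)).card =
      2 * Nat.card {x // φ x = true ∧ φ (p x) = false} := by
  classical
  rw [Nat.card_eq_fintype_card, Fintype.card_subtype]
  have h1 : (Finset.univ.filter fun x => φ x = true).card =
      (Finset.univ.filter fun x => φ (p x) = true).card :=
    (Finset.card_equiv p (by simp)).symm
  have h2 := Finset.card_filter_add_card_filter_not (s := Finset.univ.filter fun x => φ x = true)
    (fun x => φ (p x) = true)
  have h3 := Finset.card_filter_add_card_filter_not
    (s := Finset.univ.filter fun x => φ (p x) = true) (fun x => φ x = true)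
  have h4 := Finset.card_filter_add_card_filter_not
    (s := Finset.univ.filter fun x => φ x ≠ φ (p x)) (fun x => φ x = true)
  simp only [Finset.filter_filter] at h2 h3 h4
  have e1 : (Finset.univ.filter fun x => φ x = true ∧ φ (p x) = true) =
      Finset.univ.filter fun x => φ (p x) = true ∧ φ x = true := by
    ext x; simp [and_comm]
  have e2 : (Finset.univ.filter fun x => φ x ≠ φ (p x) ∧ φ x = true) =
      Finset.univ.filter fun x => φ x = true ∧ φ (p x) = false := by
    ext x
    simp only [Finset.mem_filter, Finset.mem_univ, true_and]
    cases φ x <;> cases φ (p x) <;> decide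
  have e3 : (Finset.univ.filter fun x => φ x ≠ φ (p x) ∧ ¬ φ x = true) =
      Finset.univ.filter fun x => φ (p x) = true ∧ ¬ φ x = true := by
    ext x
    simp only [Finset.mem_filter, Finset.mem_univ, true_and]
    cases φ x <;> cases φ (p x) <;> decide
  have e4 : (Finset.univ.filter fun x => φ x = true ∧ ¬ φ (p x) = true) =
      Finset.univ.filter fun x => φ x = true ∧ φ (p x) = false := by
    ext x; simp
  rw [e2, e3] at h4
  rw [e1, e4] at h2
  omega

/-- A property that holds for exactly one of `x` and `σ x` holds for half of the elements. -/
theorem two_mul_card_filter_of_involution {α : Type*} [DecidableEq α] {σ : α → α}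
    (hσ : Function.Involutive σ) {L : Finset α} (hL : ∀ x ∈ L, σ x ∈ L) {P : α → Prop}
    [DecidablePred P] (hP : ∀ x ∈ L, P x ↔ ¬ P (σ x)) : 2 * (L.filter P).card = L.card := by
  have h1 := Finset.card_filter_add_card_filter_not (s := L) P
  have h2 : (L.filter P).card = (L.filter fun x => ¬ P x).card := by
    refine Finset.card_nbij' σ σ ?_ ?_ (fun x _ => hσ x) (fun x _ => hσ x)
    · intro x hx
      simp only [Finset.coe_filter, Set.mem_ofPred_eq] at hx ⊢
      exact ⟨hL x hx.1, (hP x hx.1).1 hx.2⟩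
    · intro x hx
      simp only [Finset.coe_filter, Set.mem_ofPred_eq] at hx ⊢
      exact ⟨hL x hx.1, by rw [hP _ (hL x hx.1), hσ]; exact hx.2⟩
  omega

/-- Unlike `two_le_card_fiber`, this includes the graph with a single edge. It excludes isolated
vertices in Euler's formula. -/
theorem DartSystem.IsLaman.fiber_nonempty {V D : Type*} [DecidableEq V] [DecidableEq D]
    {M : DartSystem V D} (hM : M.IsLaman) {v : V} (hv : v ∈ M.vert) : (M.fiber v).Nonempty := by
  have h1 := hM.card_darts_le v
  have h2 := Finset.card_erase_of_mem hv
  have h3 := hM.card_darts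
  rw [← Finset.card_pos]
  by_cases h : 2 ≤ (M.vert.erase v).card
  · have := hM.sparse _ (Finset.erase_subset _ _) h
    omega
  · have := Finset.card_eq_zero.2 (hM.inner_card_le_one (X := M.vert.erase v) (by omega))
    omega

/-! ### From graphs to dart systems, and counting label changes -/

section Translation

variable {V : Type*} {G : SimpleGraph V}

/-- The dart system of a rotation system on a finite graph. -/
def RotationSystem.toDartSystem [Fintype V] [Fintype G.Dart] (R : RotationSystem G) :
    DartSystem V G.Dart where
  vert := Finset.univ
  darts := Finset.univ
  base := fun d => d.fst
  opp := SimpleGraph.Dart.symm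
  cw := R.rot.symm

theorem RotationSystem.faceNext_apply (R : RotationSystem G) (d : G.Dart) :
    R.faceNext d = R.rot.symm d.symm := rfl

variable [Fintype V] [Fintype G.Dart]

theorem card_dart_eq : Fintype.card G.Dart = 2 * G.edgeSet.ncard := by
  classical
  have h := G.dart_card_eq_twice_card_edges
  rw [← Set.ncard_coe_finset, SimpleGraph.coe_edgeFinset] at h
  convert h

variable [DecidableEq V]

theorem RotationSystem.isLaman_toDartSystem (R : RotationSystem G) (hG : IsLaman G) :
    R.toDartSystem.IsLaman where
  base_mem _ _ := Finset.mem_univ _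
  opp_mem _ _ := Finset.mem_univ _
  opp_opp d _ := d.symm_symm
  base_opp_ne d _ := d.adj.ne'
  cw_mem _ _ := Finset.mem_univ _
  base_cw d _ := by
    have := R.rot_fst (R.rot.symm d)
    rw [Equiv.apply_symm_apply] at this
    exact this.symm
  cw_trans S hS d _ e _ hde hd := by
    obtain ⟨n, -, rfl⟩ := (R.rot_cycle d e hde).inv.exists_pow_eq'
    suffices ∀ n : ℕ, (R.rot⁻¹ ^ n) d ∈ S from this n
    intro n
    induction n with
    | zero => simpa using hd
    | succ n ih =>
      rw [pow_succ']
      exact hS _ (Finset.mem_univ _) ih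
  card_darts := by
    have h1 : R.toDartSystem.darts.card = 2 * G.edgeSet.ncard := card_dart_eq
    have h2 : R.toDartSystem.vert.card = Nat.card V := Nat.card_eq_fintype_card.symm
    have := hG.card_edges
    omega
  sparse X _ hX := by
    classical
    have h1 := hG.card_induce_edges X (by rwa [Set.ncard_coe_finset])
    rw [Set.ncard_coe_finset] at h1
    have h2 : (R.toDartSystem.inner X).card ≤ Fintype.card (G.induce (X : Set V)).Dart := by
      rw [← Fintype.card_coe]
      refine Fintype.card_le_of_injective
        (fun d => ⟨⟨⟨d.1.fst, (DartSystem.mem_inner.1 d.2).2.1⟩,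
          ⟨d.1.snd, (DartSystem.mem_inner.1 d.2).2.2⟩⟩, d.1.adj⟩) ?_
      intro d e h
      exact Subtype.ext (SimpleGraph.Dart.ext _ _ (Prod.ext
        (congrArg (fun x => x.fst.1) h) (congrArg (fun x => x.snd.1) h)))
    rw [card_dart_eq] at h2
    omega

variable {R : RotationSystem G} {φ : G.Dart → Bool} {s t : V}

theorem RotationSystem.edge_rule_of_isLabeling (h : R.toDartSystem.IsLabeling φ s t) {d : G.Dart}
    (hd : d.edge ≠ s(s, t)) : φ d = φ (R.rot.symm d) ↔ φ d.symm ≠ φ (R.rot.symm d.symm) := by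
  refine h.edge d (Finset.mem_univ _) ?_
  change ¬ ((d.fst = s ∨ d.fst = t) ∧ (d.snd = s ∨ d.snd = t))
  rintro ⟨h1, h2⟩
  have hne := d.adj.ne
  apply hd
  rw [show d.edge = s(d.fst, d.snd) from rfl, Sym2.eq_iff]
  rcases h1 with h1 | h1 <;> rcases h2 with h2 | h2 <;> simp_all

/-- Labeling changes between angles that are separated by a nonspecial edge. -/
theorem RotationSystem.two_mul_card_change (hG : IsLaman G) (hst : G.Adj s t) {P : G.Dart → Prop}
    [DecidablePred P] (hP : ∀ d : G.Dart, d.edge ≠ s(s, t) → (P d ↔ ¬ P d.symm)) :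
    2 * (Finset.univ.filter fun d : G.Dart => d.edge ≠ s(s, t) ∧ P d).card + 8 =
      4 * Nat.card V := by
  classical
  set L := Finset.univ.filter fun d : G.Dart => d.edge ≠ s(s, t) with hL
  have h1 := two_mul_card_filter_of_involution (σ := SimpleGraph.Dart.symm (G := G))
    SimpleGraph.Dart.symm_involutive (L := L) (P := P) (by simp [hL]) (by
      intro d hd
      exact hP d (by simpa [hL] using hd))
  have h0 : L.filter P = Finset.univ.filter fun d : G.Dart => d.edge ≠ s(s, t) ∧ P d :=
    Finset.filter_filter _ _ _
  rw [h0] at h1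
  let e : G.Dart := ⟨(s, t), hst⟩
  have h2 : Finset.univ \ L = {e, e.symm} := by
    ext d
    simp only [hL, Finset.mem_sdiff, Finset.mem_univ, true_and, Finset.mem_filter, not_not,
      Finset.mem_insert, Finset.mem_singleton]
    exact SimpleGraph.dart_edge_eq_iff d e
  have h3 := Finset.card_sdiff_add_card_eq_card (Finset.subset_univ L)
  rw [h2, Finset.card_pair e.symm_ne.symm, Finset.card_univ, card_dart_eq] at h3
  have := hG.card_edges
  omega

/-- Every nonspecial edge contributes a change at exactly one end, and the special edge contributes
none because labels are constant at `s` and `t`. So `2n - 4` changes, hence `n - 2` drops. -/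
theorem RotationSystem.card_descent_rot (hG : IsLaman G) (hst : G.Adj s t)
    (h : R.toDartSystem.IsLabeling φ s t) :
    Nat.card {d // φ d = true ∧ φ (R.rot d) = false} + 2 = Nat.card V := by
  have h1 := card_change_eq_two_mul_card_descent R.rot φ
  have h2 := RotationSystem.two_mul_card_change hG hst (P := fun d => φ d ≠ φ (R.rot.symm d))
    (fun d hd => by
      have := R.edge_rule_of_isLabeling h hd
      tauto)
  have h3 : (Finset.univ.filter fun d => φ d ≠ φ (R.rot d)).card =
      (Finset.univ.filter fun d : G.Dart => d.edge ≠ s(s, t) ∧ φ d ≠ φ (R.rot.symm d)).card := by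
    refine Finset.card_equiv R.rot fun d => ?_
    simp only [Finset.mem_filter, Finset.mem_univ, true_and, Equiv.symm_apply_apply]
    constructor
    · refine fun hd => ⟨fun he => ?_, hd.symm⟩
      have hf := R.rot_fst d
      have : (R.rot d).fst = s ∨ (R.rot d).fst = t := by
        rw [show (R.rot d).edge = s((R.rot d).fst, (R.rot d).snd) from rfl, Sym2.eq_iff] at he
        tauto
      rcases this with hs | ht
      · exact hd ((h.label_left _ (Finset.mem_univ _) (hf.symm.trans hs)).trans
          (h.label_left _ (Finset.mem_univ _) hs).symm)
      · exact hd ((h.label_right _ (Finset.mem_univ _) (hf.symm.trans ht)).trans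
          (h.label_right _ (Finset.mem_univ _) ht).symm)
    · exact fun hd => hd.2.symm
  omega

/-- By parity, the edge rule also says that the labels at the two ends differ on exactly one side of
a nonspecial edge. The special edge has a change on both sides, so there are `2n - 2` changes and `n
- 1` drops. -/
theorem RotationSystem.card_descent_faceNext (hG : IsLaman G) (hst : G.Adj s t)
    (h : R.toDartSystem.IsLabeling φ s t) :
    Nat.card {d // φ d = true ∧ φ (R.faceNext d) = false} + 1 = Nat.card V := by
  classical
  have h1 := card_change_eq_two_mul_card_descent R.faceNext φ
  have h2 := RotationSystem.two_mul_card_change hG hst (P := fun d => φ d ≠ φ (R.faceNext d))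
    (fun d hd => by
      have := R.edge_rule_of_isLabeling h hd
      simp only [R.faceNext_apply, SimpleGraph.Dart.symm_symm]
      revert this
      cases φ d <;> cases φ d.symm <;> cases φ (R.rot.symm d) <;>
        cases φ (R.rot.symm d.symm) <;> decide)
  let e : G.Dart := ⟨(s, t), hst⟩
  have hbase : ∀ d : G.Dart, (R.faceNext d).fst = d.snd := fun d => by
    have := R.rot_fst (R.rot.symm d.symm)
    rw [Equiv.apply_symm_apply] at this
    exact this.symm
  have h3 : (Finset.univ.filter fun d => φ d ≠ φ (R.faceNext d)) =
      (Finset.univ.filter fun d : G.Dart => d.edge ≠ s(s, t) ∧ φ d ≠ φ (R.faceNext d)) ∪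
        {e, e.symm} := by
    ext d
    have he : d.edge = s(s, t) ↔ d = e ∨ d = e.symm := SimpleGraph.dart_edge_eq_iff d e
    simp only [Finset.mem_union, Finset.mem_filter, Finset.mem_univ, true_and, Finset.mem_insert,
      Finset.mem_singleton, ← he]
    have : d.edge = s(s, t) → φ d ≠ φ (R.faceNext d) := by
      rw [he]
      have hd := hbase d
      rintro (rfl | rfl)
      · rw [h.label_left e (Finset.mem_univ _) rfl, h.label_right _ (Finset.mem_univ _) hd]
        decide
      · rw [h.label_right e.symm (Finset.mem_univ _) rfl, h.label_left _ (Finset.mem_univ _) hd]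
        decide
    tauto
  have h4 := congrArg Finset.card h3
  rw [Finset.card_union_of_disjoint, Finset.card_pair e.symm_ne.symm] at h4
  · omega
  · rw [Finset.disjoint_right]
    intro d hd hd'
    have he : d.edge = s(s, t) ↔ d = e ∨ d = e.symm := SimpleGraph.dart_edge_eq_iff d e
    simp only [Finset.mem_insert, Finset.mem_singleton, Finset.mem_filter] at hd hd'
    exact hd'.2.1 (he.2 hd)

end Translation

/-! ### Pigeonhole and conclusion -/

theorem injective_of_surjective_of_card_le {α β : Type*} [Finite α] {f : α → β}
    (hf : f.Surjective) (h : Nat.card α ≤ Nat.card β) : f.Injective := by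
  have := Finite.of_surjective f hf
  exact (hf.bijective_of_nat_card_le h).1

theorem mainTheorem8 {V : Type*} (G : SimpleGraph V) (hG : IsLaman G) (E : PlaneEmbedding G) :
    ∃ (φ : E.Angle → Fin 2) (s₀ s₁ : V), IsExtendedWeakLabeling E φ s₀ s₁ := by
  classical
  have := hG.finite
  have := Fintype.ofFinite V
  set R := E.toRotationSystem with hR
  have hM := R.isLaman_toDartSystem hG
  have hV : Nonempty V := by
    have := hG.card_edges
    exact (Nat.card_pos_iff.1 (by omega)).1
  obtain ⟨v⟩ := hV
  obtain ⟨e, -⟩ := hM.fiber_nonempty (v := v) (Finset.mem_univ _)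
  set s := e.fst
  set t := e.snd
  have hst : G.Adj s t := e.adj
  obtain ⟨φ, hφ⟩ := hM.exists_isLabeling (Finset.mem_univ e) rfl rfl
  change R.toDartSystem.IsLabeling φ s t at hφ
  have rot_descent := R.card_descent_rot hG hst hφ
  have face_descent := R.card_descent_faceNext hG hst hφ
  have rot_fst : ∀ d x, R.rot.SameCycle d x → x.fst = d.fst := by
    intro d x h
    obtain ⟨n, -, rfl⟩ := h.exists_pow_eq'
    induction n with
    | zero => rfl
    | succ n ih => rw [pow_succ', Equiv.Perm.mul_apply, R.rot_fst, ih ⟨n, by simp⟩]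
  have rot_exists : ∀ v, v ≠ s → v ≠ t → ∃ d : G.Dart, d.fst = v ∧ φ d = true ∧
      φ (R.rot d) = false := by
    intro v hvs hvt
    obtain ⟨d, -, d', -, hd, hd', hne⟩ := hφ.vertex v (Finset.mem_univ _) hvs hvt
    have key : ∀ d d' : G.Dart, d.fst = v → d'.fst = v → φ d = true → φ d' = false →
        ∃ d : G.Dart, d.fst = v ∧ φ d = true ∧ φ (R.rot d) = false := by
      intro d d' hd hd' h1 h0
      obtain ⟨z, hz, hz1, hz0⟩ :=
        Equiv.Perm.exists_descent (R.rot_cycle d d' (hd.trans hd'.symm)) h1 h0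
      exact ⟨z, (rot_fst d z hz).trans hd, hz1, hz0⟩
    cases h : φ d <;> cases h' : φ d'
    · simp [h, h'] at hne
    · exact key d' d hd' hd h' h
    · exact key d d' hd hd' h h'
    · simp [h, h'] at hne
  have rot_unique : ∀ x y : G.Dart, x.fst = y.fst → φ x = true → φ (R.rot x) = false →
      φ y = true → φ (R.rot y) = false → x = y := by
    -- Drops map onto the nonspecial vertices and are equally many, so each such vertex has only
    -- one.
    let f : {d // φ d = true ∧ φ (R.rot d) = false} → {v // v ≠ s ∧ v ≠ t} := fun d =>
      ⟨d.1.fst, by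
        intro h
        simpa [d.2.1] using hφ.label_left d.1 (Finset.mem_univ _) h, by
        intro h
        simpa [d.2.2] using hφ.label_right (R.rot d.1) (Finset.mem_univ _)
          ((R.rot_fst d.1).trans h)⟩
    have hf : f.Injective := by
      apply injective_of_surjective_of_card_le
      · rintro ⟨v, hvs, hvt⟩
        obtain ⟨d, hd, h⟩ := rot_exists v hvs hvt
        exact ⟨⟨d, h⟩, Subtype.ext hd⟩
      · have h1 : Nat.card {v // v ≠ s ∧ v ≠ t} + 2 = Nat.card V := by
          rw [Nat.card_eq_fintype_card, Nat.card_eq_fintype_card, Fintype.card_subtype]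
          have : (Finset.univ.filter fun v => v ≠ s ∧ v ≠ t) = Finset.univ \ {s, t} := by
            ext; simp
          rw [this, ← Finset.card_pair hst.ne, Finset.card_sdiff_add_card_eq_card
            (Finset.subset_univ _), Finset.card_univ]
        omega
    intro x y hxy hx1 hx0 hy1 hy0
    exact congrArg Subtype.val (@hf ⟨x, hx1, hx0⟩ ⟨y, hy1, hy0⟩ (Subtype.ext hxy))
  have face_exists : ∀ d : G.Dart, ∃ x, R.faceNext.SameCycle d x ∧ φ x = true ∧
      φ (R.faceNext x) = false := by
    intro d
    have key : ∀ c, ∃ x, R.faceNext.SameCycle d x ∧ φ x ≠ c := by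
      intro c
      by_contra! hcon
      refine hφ.face c {x | R.faceNext.SameCycle d x}
        ⟨fun _ _ => Finset.mem_univ _, ⟨d, Equiv.Perm.SameCycle.refl _ _⟩, ?_, hcon⟩
      intro x hx
      exact Equiv.Perm.sameCycle_apply_right.2 hx
    obtain ⟨y, hy, hy1⟩ := key false
    obtain ⟨z, hz, hz0⟩ := key true
    obtain ⟨x, hx, h⟩ := Equiv.Perm.exists_descent (hy.symm.trans hz)
      (by simpa using hy1) (by simpa using hz0)
    exact ⟨x, hy.trans hx, h⟩
  have face_unique : ∀ x y : G.Dart, R.faceNext.SameCycle x y → φ x = true →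
      φ (R.faceNext x) = false → φ y = true → φ (R.faceNext y) = false → x = y := by
    let f : {d // φ d = true ∧ φ (R.faceNext d) = false} → R.FacialCycle := fun d =>
      Quotient.mk _ d.1
    have hf : f.Injective := by
      apply injective_of_surjective_of_card_le
      · intro c
        obtain ⟨d, rfl⟩ := Quotient.exists_rep c
        obtain ⟨x, hx, h⟩ := face_exists d
        exact ⟨⟨x, h⟩, Quotient.sound (s := Equiv.Perm.SameCycle.setoid R.faceNext) hx.symm⟩
      · have h1 : Nat.card V + (Nat.card R.FacialCycle + Nat.card {v : V // ∀ w, ¬ G.Adj v w}) =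
            G.edgeSet.ncard + 2 * Nat.card G.ConnectedComponent := E.planar
        have h2 : IsEmpty {v : V // ∀ w, ¬ G.Adj v w} := by
          refine ⟨fun ⟨v, hv⟩ => ?_⟩
          obtain ⟨d, hd⟩ := hM.fiber_nonempty (v := v) (Finset.mem_univ _)
          have hd : d.fst = v := (DartSystem.mem_fiber.1 hd).2
          exact hv d.snd (hd ▸ d.adj)
        -- Connectedness is not needed: one component already makes the number of facial cycles at
        -- least `n - 1`, the number of drops.
        have h3 : 0 < Nat.card G.ConnectedComponent :=
          Nat.card_pos_iff.2 ⟨⟨G.connectedComponentMk v⟩, inferInstance⟩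
        have h4 := hG.card_edges
        rw [Nat.card_of_isEmpty (α := {v : V // ∀ w, ¬ G.Adj v w})] at h1
        omega
    intro x y hxy hx1 hx0 hy1 hy0
    exact congrArg Subtype.val (@hf ⟨x, hx1, hx0⟩ ⟨y, hy1, hy0⟩
      (Quotient.sound (s := Equiv.Perm.SameCycle.setoid R.faceNext) hxy))
  refine ⟨fun d => if φ d then 1 else 0, s, t, hst, ?_, ?_, ?_, ?_, ?_⟩
  · intro d hd
    simp [hφ.label_left d (Finset.mem_univ _) hd]
  · intro d hd
    simp [hφ.label_right d (Finset.mem_univ _) hd]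
  · intro v hvs hvt
    obtain ⟨d, hd, h1, h0⟩ := rot_exists v hvs hvt
    refine ⟨d, hd, formsTwoIntervals_of_descent_unique (Equiv.Perm.SameCycle.refl _ _) h1 h0 ?_⟩
    intro w hw hw1 hw0
    exact rot_unique w d (rot_fst d w hw) hw1 hw0 h1 h0
  · intro d hd
    have := R.edge_rule_of_isLabeling hφ hd
    have h2 : ∀ a b : Bool, ((if a then 1 else 0 : Fin 2) = if b then 1 else 0) ↔ a = b := by
      decide
    simp only [h2]
    unfold Xor
    tauto
  · intro d
    obtain ⟨x, hx, h1, h0⟩ := face_exists d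
    refine formsTwoIntervals_of_descent_unique hx h1 h0 ?_
    intro w hw hw1 hw0
    exact face_unique w x (hw.symm.trans hx) hw1 hw0 h1 h0
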